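/- Let $\mathbf k$ be a field, $Q$ a finite quiver and $A=\mathbf kQ/I$, where $I$ is a two-sided ideal of the path algebra, homogeneous for the grading by path length and contained in $(\mathbf kQ_{>0})^2$. Write $Q_m$ for the set of paths of length $m$ (so $Q_0$ is the set of vertices $=$ trivial paths), $Q_{>0}=\bigcup_{m>0}Q_m$, and $\mathrm{len}(p)$ for the length of $p$. For paths write $p\mid q$ if $q=upv$ for some paths $u,v$, possibly trivial. Modules are right modules; $A_m$ is the component of $A$ of degree $m$ and $A_{>0}=\bigoplus_{m>0}A_m$; the product of paths is written so that the right module $e\,\mathbf kQ$ ($e\in Q_0$) has as basis the paths $p$ with $ep=p$. **Gröbner bases.** Fix an admissible order on the paths of $Q$: a well-order such that $p\ge q$ implies $pv\ge qv$ whenever $pv,qv$ are both paths and $up\ge uq$ whenever $up,uq$ are both paths, and such that $q\mid p$ implies $p\ge q$. For $0\ne x\in\mathbf kQ$ let $\mathrm{tip}(x)$ be the largest path occurring in $x$. Let $G\subset I$ be a finite Gröbner basis: for every $0\neq x\in I$ there is $0\ne g\in G$ with $\mathrm{tip}(g)\mid\mathrm{tip}(x)$. Put $S=\mathrm{tip}(G)=\{\mathrm{tip}(g):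 0\neq g\in G\}$. **Quasioverlaps.** For $p=qu$ say that $q$ *$S$-vanishes* $p$ if no $s\in S$ divides $u$, and that $q$ *almost $S$-vanishes* $p$ if $q$ does not $S$-vanish $p$ but $q$ $S$-vanishes $qu_1$ whenever $u=u_1u_2$ with $\mathrm{len}(u_2)>0$. Define $QO_0(S)=\{(w,v): w\in Q_0,\ v\in Q_{>0},\ vw=v\}$, $QO_1(S)=\{(w,v): w,v\in Q_{>0},\ vw\in S\}$, and for $n\ge2$ let $QO_n(S)$ be the set of pairs $(w,v)$ for which there are $(w_1,v)\in QO_{n-1}(S)$ and $(w_2,v)\in QO_{n-2}(S)$ such that $w_1$ $S$-vanishes $w$ and $w_2$ almost $S$-vanishes $w$. Let $minqo_n(S)$ and $maxqo_n(S)$ be the infimum and the supremum of $\mathrm{len}(w)$ over all $(w,v)\in QO_n(S)$ ($+\infty$ and $-\infty$ if $QO_n(S)=\emptyset$). **The presentation.** Let $X$ be a finitely presented $\mathbb Z$-graded $A$-module with minimal graded projective resolution $\cdots\to P_1(X)\to P_0(X)\xrightarrow{\mu_X}X\to0$ (minimal: the image of $P_{n+1}(X)$ lies in $P_n(X)A_{>0}$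 for all $n\ge0$). Write $P_0(X)=\bigoplus_{i\in T_0}f_i^0A$ with $T_0$ a finite linearly ordered set, $f_i^0$ homogeneous, and $f_i^0A\cong e_iA$ (up to a shift of degrees) via $f_i^0\mapsto e_i\in Q_0$. Let $V_X=\bigoplus_{i\in T_0}f_i^0\,\mathbf kQ$, where $f_i^0\,\mathbf kQ\cong e_i\,\mathbf kQ$; it has as basis the elements $f_i^0p$ with $e_ip=p$, of degree $\deg f_i^0+\mathrm{len}(p)$. Order this basis by: $f_i^0p\ge f_j^0q$ if $p>q$, or $p=q$ and $i\ge j$; let $\mathrm{tip}(x)$ be the largest basis element occurring in $0\ne x\in V_X$. Let $(h_i^1)_{i\in T_1}$, $({h_i^1}')_{i\in T_1'}$ be finite families of homogeneous elements of the kernel $K$ of the composition $V_X\to P_0(X)\to X$ such that 1. every element of $K$ is uniquely a sum of elements of the submodules $h_i^1\mathbf kQ$ ($i\in T_1$) and ${h_i^1}'\mathbf kQ$ ($i\in T_1'$), one from each; 2. each of these elements $h$ satisfies $h=he_h$ for some $e_h\in Q_0$; 3. ${h_i^1}'\in\bigoplus_{j\in T_0}f_j^0I$ for all $i\in T_1'$;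 4. all these elements are nonzero, and for two different members $h,\tilde h$ of the two families with tips $f_i^0p$ and $f_j^0q$ it never happens that $i=j$ and $q=pu$ for a path $u$. Let $\bar P_1(X)=\bigoplus_{i\in T_1}f_i^1A$ with $f_i^1A\cong e_{h_i^1}A[-\deg h_i^1]$; it is mapped to $P_0(X)$ by sending $f_i^1$ to the class of $h_i^1$, and $\deg f_i^1=\deg h_i^1$. **Theorem.** If $k$ and $l$ are the minimal and the maximal degrees of the generators $f_i^1$, $i\in T_1$, of $\bar P_1(X)$, then for every $n\ge1$ $$P_n(X)=\Bigl(\bigoplus_{j=k+minqo_{n-1}(\mathrm{tip}(G))}^{l+maxqo_{n-1}(\mathrm{tip}(G))}P_n(X)_j\Bigr)A .$$ -/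

import Mathlib

open scoped Classical

universe u v w

noncomputable section

/-! ### Paths in a quiver

Paths are multiplied as words: `p q` is `p` followed by `q`, so that a right module over the path
algebra is acted on by extending words on the right. -/

/-- A path of a quiver together with its end points; the trivial paths are the vertices. -/
structure QPath (V : Type u) [Quiver.{v} V] where
  src : V
  tgt : V
  path : Quiver.Path src tgt

namespace QPath

variable {V : Type u} [Quiver.{v} V]

/-- The trivial path at a vertex. -/
def vertex (a : V) : QPath V := ⟨a, a, Quiver.Path.nil⟩

/-- The length of a path. -/
def len (p : QPath V) : ℕ := p.path.length

/-- The product of two paths, `none` if they are not composable. -/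
def mul? (p q : QPath V) : Option (QPath V) :=
  if h : p.tgt = q.src then some ⟨p.src, q.tgt, p.path.comp (q.path.cast h.symm rfl)⟩ else none

/-- `p` divides `q` on the left: `q = p u`. -/
def DvdLeft (p q : QPath V) : Prop := ∃ u, mul? p u = some q

/-- `p` divides `q`: `q = u p v`. -/
def Dvd (p q : QPath V) : Prop := ∃ u v r, mul? u p = some r ∧ mul? r v = some q

theorem mul?_mk {a b c : V} (p : Quiver.Path a b) (q : Quiver.Path b c) :
    mul? ⟨a, b, p⟩ ⟨b, c, q⟩ = some ⟨a, c, p.comp q⟩ := by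
  simp [mul?]

theorem mul?_of_ne {p q : QPath V} (h : p.tgt ≠ q.src) : mul? p q = none := by
  simp [mul?, h]

theorem mul?_assoc (p q r : QPath V) :
    (mul? p q).bind (fun s => mul? s r) = (mul? q r).bind (fun s => mul? p s) := by
  obtain ⟨a, b, p⟩ := p
  obtain ⟨b', c, q⟩ := q
  obtain ⟨c', d, r⟩ := r
  by_cases h : b = b'
  · subst h
    by_cases h' : c = c'
    · subst h'
      simp [mul?_mk]
    · rw [mul?_mk, mul?_of_ne (p := ⟨b, c, q⟩) (q := ⟨c', d, r⟩) h']
      simp [mul?, h']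
  · rw [mul?_of_ne (p := ⟨a, b, p⟩) (q := ⟨b', c, q⟩) h]
    by_cases h' : c = c'
    · subst h'
      rw [mul?_mk]
      simp [mul?, h]
    · simp [mul?, h']

theorem mul?_vertex (p : QPath V) (a : V) :
    mul? p (vertex a) = if p.tgt = a then some p else none := by
  obtain ⟨b, c, p⟩ := p
  by_cases h : c = a
  · subst h
    simp [vertex, mul?_mk]
  · simp [vertex, mul?, h]

theorem vertex_mul? (p : QPath V) (a : V) :
    mul? (vertex a) p = if a = p.src then some p else none := by
  obtain ⟨b, c, p⟩ := p
  by_cases h : a = b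
  · subst h
    simp [vertex, mul?_mk]
  · simp [vertex, mul?, h]

end QPath

/-! ### The path algebra -/

/-- The path algebra `k Q`: formal linear combinations of paths. -/
def PathAlgebra (k : Type w) (V : Type u) [Field k] [Quiver.{v} V] : Type (max u v w) :=
  QPath V →₀ k

namespace PathAlgebra

variable {k : Type w} {V : Type u} [Field k] [Quiver.{v} V]

instance : AddCommGroup (PathAlgebra k V) := inferInstanceAs (AddCommGroup (QPath V →₀ k))

instance : Module k (PathAlgebra k V) := inferInstanceAs (Module k (QPath V →₀ k))

/-- The coefficient of a path in an element of the path algebra. -/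
def coeff (x : PathAlgebra k V) (p : QPath V) : k := (show QPath V →₀ k from x) p

/-- A path as an element of the path algebra. -/
def ofPath (k : Type w) [Field k] (p : QPath V) : PathAlgebra k V :=
  (Finsupp.single p 1 : QPath V →₀ k)

/-- The product of two paths in the path algebra: their concatenation, or `0`. -/
def pathMul (k : Type w) [Field k] (p q : QPath V) : PathAlgebra k V :=
  (QPath.mul? p q).elim 0 (ofPath k)

/-- The linear map on the path algebra with prescribed values on the paths. -/
def lift {M : Type*} [AddCommGroup M] [Module k M] (f : QPath V → M) : PathAlgebra k V →ₗ[k] M :=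
  Finsupp.linearCombination k f

@[simp]
theorem lift_ofPath {M : Type*} [AddCommGroup M] [Module k M] (f : QPath V → M) (p : QPath V) :
    lift (k := k) f (ofPath k p) = f p :=
  (Finsupp.linearCombination_single k (1 : k) p).trans (one_smul k (f p))

theorem hom_ext {M : Type*} [AddCommGroup M] [Module k M] {f g : PathAlgebra k V →ₗ[k] M}
    (h : ∀ p, f (ofPath k p) = g (ofPath k p)) : f = g :=
  Finsupp.lhom_ext' (M := k) (N := M) fun p => LinearMap.ext_ring (h p)

/-- Multiplication as a bilinear map: the bilinear extension of concatenation of paths. -/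
def mulₗ : PathAlgebra k V →ₗ[k] PathAlgebra k V →ₗ[k] PathAlgebra k V :=
  lift fun p => lift fun q => pathMul k p q

instance : Mul (PathAlgebra k V) := ⟨fun x y => mulₗ x y⟩

theorem mul_def (x y : PathAlgebra k V) : x * y = mulₗ x y := rfl

theorem ofPath_mul_ofPath (p q : QPath V) :
    ofPath k p * ofPath k q = pathMul k p q := by
  simp [mul_def, mulₗ]

theorem mul_assoc_aux (x y z : PathAlgebra k V) : x * y * z = x * (y * z) := by
  have h1 : ∀ p q r : QPath V, (ofPath k p * ofPath k q) * ofPath k r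
      = ofPath k p * (ofPath k q * ofPath k r) := by
    intro p q r
    have h := QPath.mul?_assoc p q r
    have e1 : (ofPath k p * ofPath k q) * ofPath k r
        = ((QPath.mul? p q).bind (fun s => QPath.mul? s r)).elim 0 (ofPath k) := by
      rw [ofPath_mul_ofPath]
      cases hpq : QPath.mul? p q with
      | none => simp [pathMul, hpq, mul_def]
      | some s => simp [pathMul, hpq, mul_def, mulₗ]
    have e2 : ofPath k p * (ofPath k q * ofPath k r)
        = ((QPath.mul? q r).bind (fun s => QPath.mul? p s)).elim 0 (ofPath k) := by
      rw [ofPath_mul_ofPath (p := q)]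
      cases hqr : QPath.mul? q r with
      | none => simp [pathMul, hqr, mul_def]
      | some s => simp [pathMul, hqr, mul_def, mulₗ]
    rw [e1, e2, h]
  have hx : ∀ p q, mulₗ (ofPath k p * ofPath k q) = (mulₗ (ofPath k p)).comp (mulₗ (ofPath k q)) :=
    fun p q => hom_ext fun r => h1 p q r
  have hy : ∀ p (z : PathAlgebra k V),
      (mulₗ.flip z).comp (mulₗ (ofPath k p)) = (mulₗ (ofPath k p)).comp (mulₗ.flip z) :=
    fun p z => hom_ext fun q => LinearMap.congr_fun (hx p q) z
  have hz : ∀ y z : PathAlgebra k V,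
      (mulₗ.flip z).comp (mulₗ.flip y) = mulₗ.flip (mulₗ y z) :=
    fun y z => hom_ext fun p => LinearMap.congr_fun (hy p z) y
  exact LinearMap.congr_fun (hz y z) x

variable [Fintype V]

instance : One (PathAlgebra k V) := ⟨∑ a : V, ofPath k (QPath.vertex a)⟩

theorem one_def : (1 : PathAlgebra k V) = ∑ a : V, ofPath k (QPath.vertex a) := rfl

theorem one_mul_aux (x : PathAlgebra k V) : 1 * x = x := by
  have : mulₗ (1 : PathAlgebra k V) = LinearMap.id := by
    refine hom_ext fun p => ?_
    rw [one_def, map_sum, LinearMap.sum_apply, Finset.sum_eq_single p.src]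
    · simp [mulₗ, pathMul, QPath.vertex_mul?]
    · intro b _ hb
      simp [mulₗ, pathMul, QPath.vertex_mul?, hb]
    · simp
  exact LinearMap.congr_fun this x

theorem mul_one_aux (x : PathAlgebra k V) : x * 1 = x := by
  have : mulₗ.flip (1 : PathAlgebra k V) = LinearMap.id := by
    refine hom_ext fun p => ?_
    rw [one_def, map_sum, LinearMap.sum_apply, Finset.sum_eq_single p.tgt]
    · simp [mulₗ, pathMul, QPath.mul?_vertex]
    · intro b _ hb
      simp [mulₗ, pathMul, QPath.mul?_vertex, Ne.symm hb]
    · simp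
  exact LinearMap.congr_fun this x

instance : Ring (PathAlgebra k V) where
  __ := (inferInstance : AddCommGroup (PathAlgebra k V))
  mul_assoc := mul_assoc_aux
  one_mul := one_mul_aux
  mul_one := mul_one_aux
  left_distrib x y z := by simp [mul_def]
  right_distrib x y z := by simp [mul_def]
  zero_mul x := by simp [mul_def]
  mul_zero x := by simp [mul_def]

instance : Algebra k (PathAlgebra k V) :=
  Algebra.ofModule (fun r x y => by simp [mul_def]) (fun r x y => by simp [mul_def])

end PathAlgebra

/-! ### Quasioverlaps -/

namespace QPath

variable {V : Type u} [Quiver.{v} V]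

/-- `q ∣_S p`: one has `p = q u`, and no element of `S` divides `u`. -/
def Vanishes (S : Set (QPath V)) (q p : QPath V) : Prop :=
  ∃ u, mul? q u = some p ∧ ∀ s ∈ S, ¬ Dvd s u

/-- `q ∣_S^a p`: one has `p = q u`, `q` does not `S`-vanish `p`, and `q` `S`-vanishes `q u₁`
whenever `u = u₁ u₂` with `u₂` of positive length. -/
def AlmostVanishes (S : Set (QPath V)) (q p : QPath V) : Prop :=
  ∃ u, mul? q u = some p ∧ ¬ Vanishes S q p ∧
    ∀ u₁ u₂ r, mul? u₁ u₂ = some u → 0 < len u₂ → mul? q u₁ = some r → Vanishes S q r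

/-- The set of `n`-quasioverlaps for `S`. -/
def quasiOverlaps (S : Set (QPath V)) : ℕ → Set (QPath V × QPath V)
  | 0 => {x | len x.1 = 0 ∧ 0 < len x.2 ∧ mul? x.2 x.1 = some x.2}
  | 1 => {x | 0 < len x.1 ∧ 0 < len x.2 ∧ ∃ s ∈ S, mul? x.2 x.1 = some s}
  | n + 2 => {x | ∃ w₁ w₂, (w₁, x.2) ∈ quasiOverlaps S (n + 1) ∧ (w₂, x.2) ∈ quasiOverlaps S n ∧
      Vanishes S w₁ x.1 ∧ AlmostVanishes S w₂ x.1}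

/-- The infimum of the lengths of `w` over the `n`-quasioverlaps `(w, v)`; `+∞` if there are
none. -/
def minqo (S : Set (QPath V)) (n : ℕ) : EReal :=
  ⨅ x ∈ quasiOverlaps S n, ((len x.1 : ℕ) : EReal)

/-- The supremum of the lengths of `w` over the `n`-quasioverlaps `(w, v)`; `-∞` if there are
none. -/
def maxqo (S : Set (QPath V)) (n : ℕ) : EReal :=
  ⨆ x ∈ quasiOverlaps S n, ((len x.1 : ℕ) : EReal)

/-- Compatibility of a linear order on the paths with multiplication and divisibility. Together
with well-foundedness this says that the order is admissible. -/
structure IsAdmissibleOrder (V : Type u) [Quiver.{v} V] [LinearOrder (QPath V)] : Prop where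
  mul_right : ∀ p q v pv qv : QPath V, q ≤ p → mul? p v = some pv → mul? q v = some qv → qv ≤ pv
  mul_left : ∀ p q u up uq : QPath V, q ≤ p → mul? u p = some up → mul? u q = some uq → uq ≤ up
  le_of_dvd : ∀ p q : QPath V, Dvd q p → q ≤ p

end QPath

/-! ### Homogeneous ideals and Gröbner bases -/

namespace PathAlgebra

variable {k : Type w} {V : Type u} [Field k] [Quiver.{v} V]

/-- The homogeneous component of degree `n` for the grading of `k Q` by the length of paths. -/
def component (n : ℕ) (x : PathAlgebra k V) : PathAlgebra k V :=
  Finsupp.filter (fun p : QPath V => p.len = n) (show QPath V →₀ k from x)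

/-- `p` is the largest path that occurs in `x`. There is no such `p` for `x = 0`. -/
def IsTip [LinearOrder (QPath V)] (x : PathAlgebra k V) (p : QPath V) : Prop :=
  x.coeff p ≠ 0 ∧ ∀ q, x.coeff q ≠ 0 → q ≤ p

/-- The set of tips of the (nonzero) elements of `G`. -/
def tipSet [LinearOrder (QPath V)] (G : Set (PathAlgebra k V)) : Set (QPath V) :=
  {p | ∃ g ∈ G, IsTip g p}

variable [Fintype V]

/-- `I` is homogeneous and contained in `(k Q_{>0})²`, the span of the paths of length at
least two. -/
structure IsHomogeneousRelationIdeal (I : Ideal (PathAlgebra k V)) : Prop where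
  component_mem : ∀ x ∈ I, ∀ n, component n x ∈ I
  two_le_len : ∀ x ∈ I, ∀ p, coeff x p ≠ 0 → 2 ≤ p.len

/-- `G ⊆ I`, and the tip of every nonzero element of `I` is divisible by the tip of an element
of `G`. -/
def IsGroebnerBasis [LinearOrder (QPath V)] (I : Ideal (PathAlgebra k V))
    (G : Set (PathAlgebra k V)) : Prop :=
  G ⊆ I ∧ ∀ x ∈ I, ∀ p, IsTip x p → ∃ q ∈ tipSet G, QPath.Dvd q p

end PathAlgebra

/-! ### Graded right modules over `A = k Q / I`

Right modules over `A` are modules over `Aᵐᵒᵖ`; thus `x a` is written `MulOpposite.op a • x`. -/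

open MulOpposite PathAlgebra

section GradedModules

variable {k : Type w} {V : Type u} [Field k] [Quiver.{v} V] [Fintype V]

/-- The component of degree `m` of `A = k Q / I`: the classes of the linear combinations of paths
of length `m`. -/
def algGrading (I : Ideal (PathAlgebra k V)) [I.IsTwoSided] (m : ℕ) : Set (PathAlgebra k V ⧸ I) :=
  Ideal.Quotient.mk I '' {x | ∀ p, coeff x p ≠ 0 → p.len = m}

variable (I : Ideal (PathAlgebra k V)) [I.IsTwoSided]

/-- `gr` is a `ℤ`-grading of the right `A`-module `M`. -/
structure IsGradedModule {M : Type*} [AddCommGroup M] [Module (PathAlgebra k V ⧸ I)ᵐᵒᵖ M]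
    (gr : ℤ → AddSubgroup M) : Prop where
  isInternal : DirectSum.IsInternal gr
  smul_mem : ∀ (i : ℤ) (m : ℕ), ∀ x ∈ gr i, ∀ a ∈ algGrading I m, op a • x ∈ gr (i + m)

/-- The submodule `M A_{>0}` of `M`. -/
def radSubmodule (M : Type*) [AddCommGroup M] [Module (PathAlgebra k V ⧸ I)ᵐᵒᵖ M] :
    Submodule (PathAlgebra k V ⧸ I)ᵐᵒᵖ M :=
  Submodule.span _ {y | ∃ (x : M) (m : ℕ), 0 < m ∧ ∃ a ∈ algGrading I m, y = op a • x}

/-- A minimal graded projective resolution `⋯ → P 1 → P 0 → X → 0` of the graded right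
`A`-module `X`. -/
structure MinimalGradedResolution {X : Type*} [AddCommGroup X]
    [Module (PathAlgebra k V ⧸ I)ᵐᵒᵖ X] (grX : ℤ → AddSubgroup X) where
  P : ℕ → Type*
  [addCommGroup : ∀ n, AddCommGroup (P n)]
  [module : ∀ n, Module (PathAlgebra k V ⧸ I)ᵐᵒᵖ (P n)]
  gr : ∀ n, ℤ → AddSubgroup (P n)
  graded : ∀ n, IsGradedModule I (gr n)
  projective : ∀ n, Module.Projective (PathAlgebra k V ⧸ I)ᵐᵒᵖ (P n)
  d : ∀ n, P (n + 1) →ₗ[(PathAlgebra k V ⧸ I)ᵐᵒᵖ] P n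
  aug : P 0 →ₗ[(PathAlgebra k V ⧸ I)ᵐᵒᵖ] X
  d_mem : ∀ n i, ∀ x ∈ gr (n + 1) i, d n x ∈ gr n i
  aug_mem : ∀ i, ∀ x ∈ gr 0 i, aug x ∈ grX i
  aug_surjective : Function.Surjective aug
  exact_zero : Function.Exact (d 0) aug
  exact_succ : ∀ n, Function.Exact (d (n + 1)) (d n)
  minimal : ∀ n, LinearMap.range (d n) ≤ radSubmodule I (P n)

attribute [instance] MinimalGradedResolution.addCommGroup MinimalGradedResolution.module

/-- A decomposition `P = ⨁ i ∈ T, f_i A` of a graded right module, where `f_i` is homogeneous of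
degree `deg i` and `f_i A ≅ e_i A` via `f_i ↦ e_i` for the vertex `e_i = vtx i`. -/
structure GradedProjectiveBasis {P : Type*} [AddCommGroup P]
    [Module (PathAlgebra k V ⧸ I)ᵐᵒᵖ P] (gr : ℤ → AddSubgroup P) (T : Type*) [Fintype T] where
  gen : T → P
  vtx : T → V
  deg : T → ℤ
  gen_mem : ∀ i, gen i ∈ gr (deg i)
  gen_vtx : ∀ i, op (Ideal.Quotient.mk I (ofPath k (QPath.vertex (vtx i)))) • gen i = gen i
  existsUnique_coords : ∀ x : P, ∃! a : T → PathAlgebra k V ⧸ I,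
    (∀ i, Ideal.Quotient.mk I (ofPath k (QPath.vertex (vtx i))) * a i = a i) ∧
      ∑ i, op (a i) • gen i = x

namespace GradedProjectiveBasis

variable {I} {P : Type*} [AddCommGroup P] [Module (PathAlgebra k V ⧸ I)ᵐᵒᵖ P]
  {gr : ℤ → AddSubgroup P} {T : Type*} [Fintype T] (B : GradedProjectiveBasis I gr T)

/-- The right `k Q`-module `⨁ i ∈ T, f_i k Q` with `f_i k Q ≅ e_i k Q`, realised by coordinate
vectors: the `i`-th coordinate lies in `e_i k Q`, and `f_i p` is the vector whose only nonzero
coordinate is `p`, in place `i`. -/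
def pathModule : Submodule (PathAlgebra k V)ᵐᵒᵖ (T → PathAlgebra k V) where
  carrier := {x | ∀ i, ofPath k (QPath.vertex (B.vtx i)) * x i = x i}
  add_mem' {x y} hx hy i := by
    have h1 := hx i
    have h2 := hy i
    simp only [Pi.add_apply, mul_add, h1, h2]
  zero_mem' i := by simp
  smul_mem' c x hx i := by
    have h1 := hx i
    simp only [Pi.smul_apply, MulOpposite.smul_eq_mul_unop, ← mul_assoc, h1]

/-- The projection of `⨁ f_i k Q` onto `P = ⨁ f_i A`. -/
def proj (x : T → PathAlgebra k V) : P := ∑ i, op (Ideal.Quotient.mk I (x i)) • B.gen i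

/-- The coordinate vector `x` is homogeneous of degree `m`, where `f_i p` has degree
`deg f_i + len p`. -/
def IsHomogeneous (x : T → PathAlgebra k V) (m : ℤ) : Prop :=
  ∀ i p, coeff (x i) p ≠ 0 → B.deg i + (p.len : ℤ) = m

end GradedProjectiveBasis

/-- `f_i p` is the tip of `x ∈ ⨁ f_i k Q`, for the order in which `f_i p ≥ f_j q` if `p > q`, or
`p = q` and `i ≥ j`. -/
def IsVecTip {T : Type*} [LinearOrder T] [LinearOrder (QPath V)] (x : T → PathAlgebra k V)
    (i : T) (p : QPath V) : Prop :=
  coeff (x i) p ≠ 0 ∧ ∀ j q, coeff (x j) q ≠ 0 → q < p ∨ (q = p ∧ j ≤ i)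

/-- The elements of a family are nonzero, and the tip `f_j p` of one of them is never a left factor
of the tip `f_j q` of another one. -/
def IsRightTipReduced {T : Type*} [LinearOrder T] [LinearOrder (QPath V)] {ι : Type*}
    (x : ι → T → PathAlgebra k V) : Prop :=
  (∀ a, x a ≠ 0) ∧ ∀ a b, a ≠ b → ∀ i p j q, IsVecTip (x a) i p → IsVecTip (x b) j q →
    ¬ (i = j ∧ QPath.DvdLeft p q)

/-- The data of a Green–Solberg presentation of `X`. Here `μ : P → X` is the projective cover and
`P = ⨁ i ∈ T₀, f_i A`. The elements `h i` (`i ∈ T₁`) are those that give the generators of the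
module `⨁ i ∈ T₁, e_{h i} A[-deg (h i)]` in the presentation; its `i`-th generator is sent to the
class of `h i` in `P` and has degree `deg i`. -/
structure GreenSolbergPresentation [LinearOrder (QPath V)] {X : Type*} [AddCommGroup X]
    [Module (PathAlgebra k V ⧸ I)ᵐᵒᵖ X] {P : Type*} [AddCommGroup P]
    [Module (PathAlgebra k V ⧸ I)ᵐᵒᵖ P] {gr : ℤ → AddSubgroup P}
    (μ : P →ₗ[(PathAlgebra k V ⧸ I)ᵐᵒᵖ] X) {T₀ : Type*} [Fintype T₀] [LinearOrder T₀]
    (B : GradedProjectiveBasis I gr T₀) (T₁ T₁' : Type*) [Fintype T₁] [Fintype T₁'] where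
  h : T₁ → T₀ → PathAlgebra k V
  h' : T₁' → T₀ → PathAlgebra k V
  deg : T₁ → ℤ
  deg' : T₁' → ℤ
  homogeneous : ∀ i, B.IsHomogeneous (h i) (deg i)
  homogeneous' : ∀ i, B.IsHomogeneous (h' i) (deg' i)
  mem_ker : ∀ i, Sum.elim h h' i ∈ B.pathModule ∧ μ (B.proj (Sum.elim h h' i)) = 0
  existsUnique_sum : ∀ x ∈ B.pathModule, μ (B.proj x) = 0 →
    ∃! y : T₁ ⊕ T₁' → T₀ → PathAlgebra k V,
      (∀ i, y i ∈ Submodule.span (PathAlgebra k V)ᵐᵒᵖ {Sum.elim h h' i}) ∧ ∑ i, y i = x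
  exists_vertex : ∀ i, ∃ e : V, ∀ j,
    Sum.elim h h' i j * ofPath k (QPath.vertex e) = Sum.elim h h' i j
  h'_mem : ∀ i j, h' i j ∈ I
  tipReduced : IsRightTipReduced (Sum.elim h h')

end GradedModules

end

/-! A resolution of the kernel of `R.aug`, in general not minimal, is built from words, and its
generators have degrees governed by quasioverlaps. A minimal resolution needs no generators in other
degrees.

Construction. Every basis element `t u` of every module in the resolution is ordered through the
underlying element of `⨁ f_i k Q`, namely `t.word` followed by `u` in the place of `t`. As long as
the index words are prefix-free (`IsPrefixFree`), distinct basis elements have distinct positions. A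
map sending each generator to a vector whose leading term has the same position then preserves
leading positions: nothing can cancel (`IsLeadFamily.isLead_evalMap`). Hence `t w` is a leading term
of a vector that becomes a cycle modulo `I` exactly when `t.tail w` is divisible by a tip of the
Gröbner basis. One direction is `IsLeadFamily.not_isReduced_of_isLead`, the other is division with
remainder in `IsResolutionStep.exists_mem_stepKernel`. The minimal reduced such `w` are the last
syllables of the next generators (`nextSet`). They are again prefix-free, so the construction
iterates (`IsResolutionStep.exists_next`). It starts from the reduced tips of the presentation. Tips
of the `h'` are never reduced, because their entries lie in `I`.

Degrees. Unwinding the minimality conditions, the word of a generator at stage `n` is an initial tip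
followed by the first component of an `n`-quasioverlap (`exists_quasiOverlap_of_chainSet`). Its
degree is therefore some `deg (h i)` plus the length of that component.

Comparison. The composite of comparison maps from the minimal resolution to the constructed one and
back is homotopic to the identity. By minimality the homotopy terms lie in the radical, so a degree
without generators in the constructed module is contained in the radical of the minimal one
(`MinimalGradedResolution.mem_radSubmodule`). A graded Nakayama argument for projective modules
(`span_eq_top_of_forall_notMem`) finishes the proof. -/

noncomputable section

open MulOpposite PathAlgebra

/-! ### Concatenation, cancellation and divisibility of paths -/

namespace QPath

variable {V : Type u} [Quiver.{v} V]

/-- The product of two composable paths. -/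
def cat (p q : QPath V) : QPath V := (mul? p q).getD p

theorem mul?_cat {p q : QPath V} (h : p.tgt = q.src) : mul? p q = some (cat p q) := by
  simp [cat, mul?, h]

theorem mul?_eq_some_iff {p q r : QPath V} :
    mul? p q = some r ↔ p.tgt = q.src ∧ cat p q = r := by
  by_cases h : p.tgt = q.src
  · simp [mul?_cat h, h]
  · simp [mul?_of_ne h, h]

theorem cat_mk {a b c : V} (p : Quiver.Path a b) (q : Quiver.Path b c) :
    cat ⟨a, b, p⟩ ⟨b, c, q⟩ = ⟨a, c, p.comp q⟩ := by
  simp [cat, mul?_mk]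

-- No composability is needed: for non-composable paths `cat` takes the left factor as its default
-- value.
@[simp]
theorem cat_src (p q : QPath V) : (cat p q).src = p.src := by
  by_cases h : p.tgt = q.src
  · simp [cat, mul?, h]
  · simp [cat, mul?_of_ne h]

theorem cat_tgt {p q : QPath V} (h : p.tgt = q.src) : (cat p q).tgt = q.tgt := by
  simp [cat, mul?, h]

theorem len_cat {p q : QPath V} (h : p.tgt = q.src) : len (cat p q) = len p + len q := by
  obtain ⟨a, b, p⟩ := p
  obtain ⟨b', c, q⟩ := q
  cases h
  rw [cat_mk]
  simp [len]

theorem cat_assoc {p q r : QPath V} (h : p.tgt = q.src) (h' : q.tgt = r.src) :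
    cat (cat p q) r = cat p (cat q r) := by
  obtain ⟨a, b, p⟩ := p
  obtain ⟨b', c, q⟩ := q
  obtain ⟨c', d, r⟩ := r
  cases h
  cases h'
  simp [cat_mk]

@[simp]
theorem vertex_src (a : V) : (vertex a).src = a := rfl

@[simp]
theorem vertex_tgt (a : V) : (vertex a).tgt = a := rfl

@[simp]
theorem len_vertex (a : V) : len (vertex a) = 0 := rfl

theorem cat_vertex {p : QPath V} {a : V} (h : p.tgt = a) : cat p (vertex a) = p := by
  simp [cat, mul?_vertex, h]

theorem vertex_cat {p : QPath V} {a : V} (h : a = p.src) : cat (vertex a) p = p := by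
  simp [cat, vertex_mul?, h]

theorem eq_vertex_of_len_eq_zero {p : QPath V} (h : len p = 0) : p = vertex p.src := by
  obtain ⟨a, b, p⟩ := p
  cases p with
  | nil => rfl
  | cons p e => simp [len] at h

theorem src_eq_tgt_of_len_eq_zero {p : QPath V} (h : len p = 0) : p.src = p.tgt := by
  rw [eq_vertex_of_len_eq_zero h]
  rfl

theorem cat_of_len_eq_zero {p q : QPath V} (h : p.tgt = q.src) (hq : len q = 0) :
    cat p q = p := by
  rw [eq_vertex_of_len_eq_zero hq]
  exact cat_vertex h

theorem cat_left_cancel {p q r : QPath V} (hq : p.tgt = q.src) (hr : p.tgt = r.src)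
    (h : cat p q = cat p r) : q = r := by
  obtain ⟨a, b, p⟩ := p
  obtain ⟨b', c, q⟩ := q
  obtain ⟨b'', c', r⟩ := r
  cases hq
  cases hr
  rw [cat_mk, cat_mk] at h
  obtain ⟨-, rfl, h⟩ := QPath.mk.inj h
  rw [heq_eq_eq, Quiver.Path.comp_inj_right] at h
  rw [h]

theorem cat_right_cancel {p q r : QPath V} (hp : p.tgt = r.src) (hq : q.tgt = r.src)
    (h : cat p r = cat q r) : p = q := by
  obtain ⟨a, b, p⟩ := p
  obtain ⟨a', b', q⟩ := q
  obtain ⟨b'', c, r⟩ := r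
  cases hp
  cases hq
  rw [cat_mk, cat_mk] at h
  obtain ⟨rfl, -, h⟩ := QPath.mk.inj h
  rw [heq_eq_eq, Quiver.Path.comp_inj_left] at h
  rw [h]

/-- Two factorizations of a path have a common refinement. -/
theorem comp_eq_comp {a b b' c : V} (p : Quiver.Path a b) (u : Quiver.Path b c)
    (q : Quiver.Path a b') (v : Quiver.Path b' c) (h : p.comp u = q.comp v) :
    (∃ w, q = p.comp w ∧ u = w.comp v) ∨ (∃ w, p = q.comp w ∧ v = w.comp u) := by
  induction u with
  | nil => exact Or.inr ⟨v, h, rfl⟩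
  | cons u e ih =>
    cases v with
    | nil => exact Or.inl ⟨_, h.symm, rfl⟩
    | cons v e' =>
      rw [Quiver.Path.comp_cons, Quiver.Path.comp_cons] at h
      injection h with h1 _ h2 h3
      subst h1
      obtain rfl := eq_of_heq h3
      rcases ih v (eq_of_heq h2) with ⟨w, rfl, rfl⟩ | ⟨w, rfl, rfl⟩
      · exact Or.inl ⟨w, rfl, rfl⟩
      · exact Or.inr ⟨w, rfl, rfl⟩

theorem cat_eq_cat {p q u v : QPath V} (hp : p.tgt = u.src) (hq : q.tgt = v.src)
    (h : cat p u = cat q v) :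
    (∃ w, p.tgt = w.src ∧ w.tgt = v.src ∧ q = cat p w ∧ u = cat w v) ∨
      (∃ w, q.tgt = w.src ∧ w.tgt = u.src ∧ p = cat q w ∧ v = cat w u) := by
  obtain ⟨a, b, p⟩ := p
  obtain ⟨a', b', q⟩ := q
  obtain ⟨_, c, u⟩ := u
  obtain ⟨_, c', v⟩ := v
  cases hp
  cases hq
  rw [cat_mk, cat_mk] at h
  obtain ⟨rfl, rfl, h⟩ := QPath.mk.inj h
  rcases comp_eq_comp p u q v (eq_of_heq h) with ⟨w, rfl, rfl⟩ | ⟨w, rfl, rfl⟩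
  · exact Or.inl ⟨⟨_, _, w⟩, rfl, rfl, (cat_mk _ _).symm, (cat_mk _ _).symm⟩
  · exact Or.inr ⟨⟨_, _, w⟩, rfl, rfl, (cat_mk _ _).symm, (cat_mk _ _).symm⟩

theorem dvdLeft_iff {p q : QPath V} : DvdLeft p q ↔ ∃ u, p.tgt = u.src ∧ cat p u = q := by
  simp [DvdLeft, mul?_eq_some_iff]

theorem dvd_iff {p q : QPath V} :
    Dvd p q ↔ ∃ u v, u.tgt = p.src ∧ p.tgt = v.src ∧ cat (cat u p) v = q := by
  constructor
  · rintro ⟨u, v, r, h, h'⟩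
    rw [mul?_eq_some_iff] at h h'
    obtain ⟨h, rfl⟩ := h
    exact ⟨u, v, h, by rw [← h'.1, cat_tgt h], h'.2⟩
  · rintro ⟨u, v, h, h', rfl⟩
    exact ⟨u, v, _, mul?_cat h, mul?_cat (by rw [cat_tgt h, h'])⟩

/-- No element of `S` divides `u`. -/
def IsReduced (S : Set (QPath V)) (u : QPath V) : Prop := ∀ s ∈ S, ¬ Dvd s u

variable {S : Set (QPath V)}

theorem IsReduced.left {u v : QPath V} (h : u.tgt = v.src) (hr : IsReduced S (cat u v)) :
    IsReduced S u := by
  intro s hs hd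
  obtain ⟨a, b, ha, hb, rfl⟩ := dvd_iff.1 hd
  have hc : (cat a s).tgt = b.src := by rw [cat_tgt ha, hb]
  rw [cat_tgt hc] at h
  exact hr s hs (dvd_iff.2 ⟨a, cat b v, ha, by simpa using hb, (cat_assoc hc h).symm⟩)

theorem IsReduced.right {u v : QPath V} (h : u.tgt = v.src) (hr : IsReduced S (cat u v)) :
    IsReduced S v := by
  intro s hs hd
  obtain ⟨a, b, ha, hb, rfl⟩ := dvd_iff.1 hd
  have hc : (cat a s).tgt = b.src := by rw [cat_tgt ha, hb]
  rw [cat_src, cat_src] at h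
  refine hr s hs (dvd_iff.2 ⟨cat u a, b, by rw [cat_tgt h, ha], hb, ?_⟩)
  rw [cat_assoc h ha, cat_assoc (by simpa using h) hc]

theorem vanishes_cat_iff {q u : QPath V} (h : q.tgt = u.src) :
    Vanishes S q (cat q u) ↔ IsReduced S u := by
  constructor
  · rintro ⟨u', hu, hr⟩
    obtain ⟨h', e⟩ := mul?_eq_some_iff.1 hu
    rwa [cat_left_cancel h' h e] at hr
  · exact fun hr => ⟨u, mul?_cat h, hr⟩

/-! ### Order -/

theorem IsAdmissibleOrder.cat_lt_cat_right [LinearOrder (QPath V)] (hord : IsAdmissibleOrder V)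
    {p q w : QPath V} (hp : p.tgt = w.src) (hq : q.tgt = w.src) (h : p < q) :
    cat p w < cat q w :=
  lt_of_le_of_ne (hord.mul_right q p w _ _ h.le (mul?_cat hq) (mul?_cat hp))
    fun e => h.ne (cat_right_cancel hp hq e)

theorem IsAdmissibleOrder.cat_lt_cat_left [LinearOrder (QPath V)] (hord : IsAdmissibleOrder V)
    {p q w : QPath V} (hp : w.tgt = p.src) (hq : w.tgt = q.src) (h : p < q) :
    cat w p < cat w q :=
  lt_of_le_of_ne (hord.mul_left q p w _ _ h.le (mul?_cat hq) (mul?_cat hp))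
    fun e => h.ne (cat_left_cancel hp hq e)

theorem IsAdmissibleOrder.cat_le_cat_left_iff [LinearOrder (QPath V)] (hord : IsAdmissibleOrder V)
    {p q w : QPath V} (hp : w.tgt = p.src) (hq : w.tgt = q.src) :
    cat w p ≤ cat w q ↔ p ≤ q :=
  ⟨fun h => not_lt.1 fun hlt => (hord.cat_lt_cat_left hq hp hlt).not_ge h,
    fun h => hord.mul_left q p w _ _ h (mul?_cat hq) (mul?_cat hp)⟩

end QPath

/-! ### Coefficients and products in the path algebra -/

namespace PathAlgebra

variable {k : Type w} {V : Type u} [Field k] [Quiver.{v} V]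

theorem coeff_ext {x y : PathAlgebra k V} (h : ∀ p, coeff x p = coeff y p) : x = y :=
  Finsupp.ext h

@[simp]
theorem coeff_zero (p : QPath V) : coeff (0 : PathAlgebra k V) p = 0 := rfl

@[simp]
theorem coeff_add (x y : PathAlgebra k V) (p : QPath V) :
    coeff (x + y) p = coeff x p + coeff y p := rfl

@[simp]
theorem coeff_sub (x y : PathAlgebra k V) (p : QPath V) :
    coeff (x - y) p = coeff x p - coeff y p := rfl

@[simp]
theorem coeff_smul (c : k) (x : PathAlgebra k V) (p : QPath V) :
    coeff (c • x) p = c * coeff x p := rfl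

theorem coeff_ofPath (p q : QPath V) : coeff (ofPath k p) q = if p = q then 1 else 0 :=
  Finsupp.single_apply

@[simp]
theorem coeff_ofPath_self (p : QPath V) : coeff (ofPath k p) p = 1 := by
  simp [coeff_ofPath]

theorem eq_of_coeff_ofPath_ne_zero {p q : QPath V} (h : coeff (ofPath k p) q ≠ 0) : p = q := by
  by_contra hne
  simp [coeff_ofPath, hne] at h

theorem coeff_component (n : ℕ) (x : PathAlgebra k V) (p : QPath V) :
    coeff (component n x) p = if p.len = n then coeff x p else 0 :=
  Finsupp.filter_apply _ _ _

theorem finite_coeff (x : PathAlgebra k V) : {p | coeff x p ≠ 0}.Finite :=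
  Finsupp.hasFiniteSupport (show QPath V →₀ k from x)

theorem coeff_sum {ι : Type*} (s : Finset ι) (x : ι → PathAlgebra k V) (p : QPath V) :
    coeff (∑ i ∈ s, x i) p = ∑ i ∈ s, coeff (x i) p :=
  Finsupp.finsetSum_apply s (fun i => (show QPath V →₀ k from x i)) p

theorem eq_sum (x : PathAlgebra k V) :
    x = ∑ p ∈ (finite_coeff x).toFinset, coeff x p • ofPath k p := by
  refine coeff_ext fun q => ?_
  simp only [coeff_sum, coeff_smul, coeff_ofPath, mul_ite, mul_one, mul_zero, Finset.sum_ite_eq']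
  by_cases h : coeff x q = 0 <;> simp [h]

@[elab_as_elim]
theorem induction_on {P : PathAlgebra k V → Prop} (x : PathAlgebra k V) (zero : P 0)
    (add : ∀ x y, P x → P y → P (x + y)) (single : ∀ (c : k) p, P (c • ofPath k p)) : P x := by
  refine Finsupp.induction_linear (motive := fun x : QPath V →₀ k => P x) x zero add ?_
  intro p c
  have : (Finsupp.single p c : QPath V →₀ k) = c • (Finsupp.single p 1 : QPath V →₀ k) := by simp
  rw [this]
  exact single c p

theorem add_mul_aux (x y z : PathAlgebra k V) : (x + y) * z = x * z + y * z := by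
  simp [mul_def]

theorem mul_add_aux (x y z : PathAlgebra k V) : x * (y + z) = x * y + x * z := by
  simp [mul_def]

theorem smul_mul_aux (c : k) (x y : PathAlgebra k V) : (c • x) * y = c • (x * y) := by
  simp [mul_def]

theorem mul_smul_aux (c : k) (x y : PathAlgebra k V) : x * (c • y) = c • (x * y) := by
  simp [mul_def]

theorem coeff_ofPath_mul_ofPath (p q r : QPath V) :
    coeff (ofPath k p * ofPath k q) r = if QPath.mul? p q = some r then 1 else 0 := by
  rw [ofPath_mul_ofPath, pathMul]
  cases h : QPath.mul? p q with
  | none => simp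
  | some s => simp [coeff_ofPath]

theorem exists_of_coeff_mul_ne_zero {x y : PathAlgebra k V} {r : QPath V}
    (h : coeff (x * y) r ≠ 0) :
    ∃ p q, QPath.mul? p q = some r ∧ coeff x p ≠ 0 ∧ coeff y q ≠ 0 := by
  rw [eq_sum x, eq_sum y, mul_def, map_sum, coeff_sum] at h
  obtain ⟨q, hq, h⟩ := Finset.exists_ne_zero_of_sum_ne_zero h
  rw [map_sum, LinearMap.sum_apply, coeff_sum] at h
  obtain ⟨p, hp, h⟩ := Finset.exists_ne_zero_of_sum_ne_zero h
  rw [← mul_def, smul_mul_aux, mul_smul_aux, coeff_smul, coeff_smul, coeff_ofPath_mul_ofPath] at h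
  refine ⟨p, q, ?_, (finite_coeff x).mem_toFinset.1 hp, (finite_coeff y).mem_toFinset.1 hq⟩
  by_contra hne
  simp [hne] at h

theorem coeff_mul_ofPath (x : PathAlgebra k V) {p q r : QPath V} (h : QPath.mul? p q = some r) :
    coeff (x * ofPath k q) r = coeff x p := by
  induction x using induction_on with
  | zero => simp [mul_def]
  | add x y hx hy => rw [add_mul_aux, coeff_add, hx, hy, coeff_add]
  | single c s =>
    rw [smul_mul_aux, coeff_smul, coeff_ofPath_mul_ofPath, coeff_smul, coeff_ofPath]
    congr 2
    rw [eq_iff_iff]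
    constructor
    · intro h'
      rw [QPath.mul?_eq_some_iff] at h h'
      exact QPath.cat_right_cancel h'.1 h.1 (h'.2.trans h.2.symm)
    · rintro rfl
      exact h

theorem coeff_ofPath_mul (x : PathAlgebra k V) {p q r : QPath V} (h : QPath.mul? p q = some r) :
    coeff (ofPath k p * x) r = coeff x q := by
  induction x using induction_on with
  | zero => simp [mul_def]
  | add x y hx hy => rw [mul_add_aux, coeff_add, hx, hy, coeff_add]
  | single c s =>
    rw [mul_smul_aux, coeff_smul, coeff_ofPath_mul_ofPath, coeff_smul, coeff_ofPath]
    congr 2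
    rw [eq_iff_iff]
    constructor
    · intro h'
      rw [QPath.mul?_eq_some_iff] at h h'
      exact QPath.cat_left_cancel h'.1 h.1 (h'.2.trans h.2.symm)
    · rintro rfl
      exact h

theorem vertex_mul_eq_iff {x : PathAlgebra k V} {a : V} :
    ofPath k (QPath.vertex a) * x = x ↔ ∀ p, coeff x p ≠ 0 → p.src = a := by
  constructor
  · intro h p hp
    rw [← h] at hp
    obtain ⟨q, r, hm, hq, -⟩ := exists_of_coeff_mul_ne_zero hp
    obtain rfl := eq_of_coeff_ofPath_ne_zero hq
    rw [QPath.mul?_eq_some_iff] at hm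
    rw [← hm.2]
    simp
  · intro h
    refine coeff_ext fun p => ?_
    by_cases hp : a = p.src
    · exact coeff_ofPath_mul x (by simp [QPath.vertex_mul?, hp])
    · have h0 : coeff x p = 0 := by
        by_contra hne
        exact hp (h p hne).symm
      rw [h0]
      by_contra hne
      obtain ⟨q, r, hm, hq, hr⟩ := exists_of_coeff_mul_ne_zero hne
      obtain rfl := eq_of_coeff_ofPath_ne_zero hq
      rw [QPath.mul?_eq_some_iff] at hm
      rw [← hm.2] at hp
      simp at hp

theorem mul_vertex_eq_iff {x : PathAlgebra k V} {a : V} :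
    x * ofPath k (QPath.vertex a) = x ↔ ∀ p, coeff x p ≠ 0 → p.tgt = a := by
  constructor
  · intro h p hp
    rw [← h] at hp
    obtain ⟨q, r, hm, -, hr⟩ := exists_of_coeff_mul_ne_zero hp
    obtain rfl := eq_of_coeff_ofPath_ne_zero hr
    rw [QPath.mul?_eq_some_iff] at hm
    rw [← hm.2, QPath.cat_tgt hm.1]
    simp
  · intro h
    refine coeff_ext fun p => ?_
    by_cases hp : p.tgt = a
    · exact coeff_mul_ofPath x (by simp [QPath.mul?_vertex, hp])
    · have h0 : coeff x p = 0 := by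
        by_contra hne
        exact hp (h p hne)
      rw [h0]
      by_contra hne
      obtain ⟨q, r, hm, hq, hr⟩ := exists_of_coeff_mul_ne_zero hne
      obtain rfl := eq_of_coeff_ofPath_ne_zero hr
      rw [QPath.mul?_eq_some_iff] at hm
      rw [← hm.2, QPath.cat_tgt hm.1] at hp
      simp at hp

end PathAlgebra

/-! ### Maps out of free right modules -/

section EvalMap

variable {R M ι : Type*} [Ring R] [AddCommGroup M] [Module Rᵐᵒᵖ M]

/-- The right linear map `R → M` that sends `1` to `m`. -/
def actionMap (m : M) : R →ₗ[Rᵐᵒᵖ] M where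
  toFun a := op a • m
  map_add' a b := by rw [op_add, add_smul]
  map_smul' c a := by
    rw [MulOpposite.smul_eq_mul_unop, op_mul, op_unop, mul_smul, RingHom.id_apply]

/-- The right linear map from the free right module on `ι` with prescribed values on the basis. -/
def evalMap (m : ι → M) : (ι →₀ R) →ₗ[Rᵐᵒᵖ] M := Finsupp.lsum ℕ fun i => actionMap (m i)

@[simp]
theorem evalMap_single (m : ι → M) (i : ι) (a : R) :
    evalMap m (Finsupp.single i a) = op a • m i := by
  rw [evalMap, Finsupp.lsum_single]
  rfl

theorem evalMap_apply (m : ι → M) (x : ι →₀ R) :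
    evalMap m x = ∑ i ∈ x.support, op (x i) • m i := rfl

end EvalMap

/-! ### Index words and vectors over the path algebra -/

/-- Indices for the generators of the resolution: a place, a word, and the last syllable of that
word. -/
@[ext]
structure TipIndex (T₀ : Type*) (V : Type u) [Quiver.{v} V] where
  place : T₀
  word : QPath V
  tail : QPath V

section Vectors

variable {k : Type w} {V : Type u} [Field k] [Quiver.{v} V] {T₀ : Type*}

/-- The index obtained by appending a path. -/
def TipIndex.append (t : TipIndex T₀ V) (u : QPath V) : TipIndex T₀ V :=
  ⟨t.place, QPath.cat t.word u, u⟩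

/-- The degree and the target of the basis element `t u`. -/
def TipIndex.cls (deg : T₀ → ℤ) (t : TipIndex T₀ V) (u : QPath V) : ℤ × V :=
  (deg t.place + t.word.len + u.len, u.tgt)

/-- The position in the order of the basis element `t u`. -/
def TipIndex.key (t : TipIndex T₀ V) (u : QPath V) : QPath V ×ₗ T₀ :=
  toLex (QPath.cat t.word u, t.place)

/-- No word of a member of `T` is a left factor of the word of another one in the same place. -/
def IsPrefixFree (T : Set (TipIndex T₀ V)) : Prop :=
  ∀ t ∈ T, ∀ t' ∈ T, t.place = t'.place → QPath.DvdLeft t.word t'.word → t = t'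

/-- The basis element `t u` occurs in `x`. -/
def Occurs (x : TipIndex T₀ V →₀ PathAlgebra k V) (t : TipIndex T₀ V) (u : QPath V) : Prop :=
  coeff (x t) u ≠ 0

/-- `x` lies in the sum of the modules `t k Q`, `t ∈ T`. -/
def IsSupportedOn (T : Set (TipIndex T₀ V)) (x : TipIndex T₀ V →₀ PathAlgebra k V) : Prop :=
  ∀ t u, Occurs x t u → t ∈ T ∧ t.word.tgt = u.src

theorem Occurs.of_add {x y : TipIndex T₀ V →₀ PathAlgebra k V} {t : TipIndex T₀ V} {u : QPath V}
    (h : Occurs (x + y) t u) : Occurs x t u ∨ Occurs y t u := by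
  by_contra hne
  simp only [Occurs, not_or, not_not] at hne
  simp [Occurs, hne.1, hne.2] at h

theorem Occurs.of_sub {x y : TipIndex T₀ V →₀ PathAlgebra k V} {t : TipIndex T₀ V} {u : QPath V}
    (h : Occurs (x - y) t u) : Occurs x t u ∨ Occurs y t u := by
  by_contra hne
  simp only [Occurs, not_or, not_not] at hne
  simp [Occurs, hne.1, hne.2] at h

theorem not_occurs_zero {t : TipIndex T₀ V} {u : QPath V} :
    ¬ Occurs (0 : TipIndex T₀ V →₀ PathAlgebra k V) t u := by
  simp [Occurs]

theorem occurs_single_iff {t t' : TipIndex T₀ V} {a : PathAlgebra k V} {u : QPath V} :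
    Occurs (Finsupp.single t a) t' u ↔ t = t' ∧ coeff a u ≠ 0 := by
  by_cases h : t = t'
  · subst h
    simp [Occurs]
  · simp [Occurs, h]

theorem occurs_single_smul_ofPath {t t' : TipIndex T₀ V} {c : k} {w u : QPath V}
    (h : Occurs (Finsupp.single t (c • ofPath k w)) t' u) : t = t' ∧ w = u := by
  obtain ⟨h1, h2⟩ := occurs_single_iff.1 h
  refine ⟨h1, eq_of_coeff_ofPath_ne_zero (k := k) fun h0 => h2 ?_⟩
  rw [coeff_smul, h0, mul_zero]

theorem isSupportedOn_single {T : Set (TipIndex T₀ V)} {t : TipIndex T₀ V} (ht : t ∈ T)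
    {a : PathAlgebra k V} (ha : ∀ u, coeff a u ≠ 0 → t.word.tgt = u.src) :
    IsSupportedOn T (Finsupp.single t a) := by
  intro t' u h
  obtain ⟨rfl, hu⟩ := occurs_single_iff.1 h
  exact ⟨ht, ha u hu⟩

theorem isSupportedOn_single_smul_ofPath {T : Set (TipIndex T₀ V)} {t : TipIndex T₀ V}
    (ht : t ∈ T) (c : k) {w : QPath V} (hw : t.word.tgt = w.src) :
    IsSupportedOn T (Finsupp.single t (c • ofPath k w)) := by
  intro t' u h
  obtain ⟨rfl, rfl⟩ := occurs_single_smul_ofPath h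
  exact ⟨ht, hw⟩

theorem IsSupportedOn.sub {T : Set (TipIndex T₀ V)} {x y : TipIndex T₀ V →₀ PathAlgebra k V}
    (hx : IsSupportedOn T x) (hy : IsSupportedOn T y) : IsSupportedOn T (x - y) :=
  fun t u h => h.of_sub.elim (hx t u) (hy t u)

theorem IsSupportedOn.add {T : Set (TipIndex T₀ V)} {x y : TipIndex T₀ V →₀ PathAlgebra k V}
    (hx : IsSupportedOn T x) (hy : IsSupportedOn T y) : IsSupportedOn T (x + y) :=
  fun t u h => h.of_add.elim (hx t u) (hy t u)

theorem finite_occurs (x : TipIndex T₀ V →₀ PathAlgebra k V) :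
    {p : TipIndex T₀ V × QPath V | Occurs x p.1 p.2}.Finite := by
  refine ((x.support.finite_toSet.biUnion fun t _ =>
    (finite_coeff (x t)).image fun u => (t, u))).subset ?_
  rintro ⟨t, u⟩ h
  refine Set.mem_biUnion (x := t) ?_ ⟨u, h, rfl⟩
  refine Finset.mem_coe.2 (Finsupp.mem_support_iff.2 fun h0 => h ?_)
  simp [h0]

theorem exists_occurs {x : TipIndex T₀ V →₀ PathAlgebra k V} (hx : x ≠ 0) :
    ∃ t u, Occurs x t u := by
  by_contra! h
  refine hx (Finsupp.ext fun t => coeff_ext fun u => ?_)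
  simpa [Occurs] using h t u

/-- Equal total words are two factorizations of one path, so one index word is a left factor of the
other. This is what makes the position of a basis element a faithful label and leading terms unique.
-/
theorem IsPrefixFree.key_injective {T : Set (TipIndex T₀ V)} (hT : IsPrefixFree T)
    {t t' : TipIndex T₀ V} (ht : t ∈ T) (ht' : t' ∈ T) {u u' : QPath V} (hu : t.word.tgt = u.src)
    (hu' : t'.word.tgt = u'.src) (h : t.key u = t'.key u') : t = t' ∧ u = u' := by
  obtain ⟨h1, h2⟩ := Prod.mk.inj (toLex.injective h)
  have key : t = t' := by
    rcases QPath.cat_eq_cat hu hu' h1 with ⟨w, hw, -, e, -⟩ | ⟨w, hw, -, e, -⟩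
    · exact hT t ht t' ht' h2 (QPath.dvdLeft_iff.2 ⟨w, hw, e.symm⟩)
    · exact (hT t' ht' t ht h2.symm (QPath.dvdLeft_iff.2 ⟨w, hw, e.symm⟩)).symm
  subst key
  exact ⟨rfl, QPath.cat_left_cancel hu hu' h1⟩

theorem TipIndex.key_cat {t : TipIndex T₀ V} {u w : QPath V} (hu : t.word.tgt = u.src)
    (hw : u.tgt = w.src) : t.key (QPath.cat u w) = (t.append u).key w := by
  simp only [key, append]
  rw [QPath.cat_assoc hu hw]

theorem TipIndex.key_tail {r t : TipIndex T₀ V} (h1 : r.word.tgt = t.tail.src) (h2 : r.append t.tail = t)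
    {w : QPath V} (hw : t.tail.tgt = w.src) : r.key (QPath.cat t.tail w) = t.key w := by
  rw [TipIndex.key_cat h1 hw, h2]

section Eval

variable [Fintype V]

theorem IsSupportedOn.smul {T : Set (TipIndex T₀ V)} {x : TipIndex T₀ V →₀ PathAlgebra k V}
    (hx : IsSupportedOn T x) (c : (PathAlgebra k V)ᵐᵒᵖ) : IsSupportedOn T (c • x) := by
  intro t u h
  rw [Occurs, Finsupp.smul_apply, MulOpposite.smul_eq_mul_unop] at h
  obtain ⟨p, q, hm, hp, -⟩ := exists_of_coeff_mul_ne_zero h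
  obtain ⟨h1, h2⟩ := hx t p hp
  refine ⟨h1, h2.trans ?_⟩
  rw [← (QPath.mul?_eq_some_iff.1 hm).2, QPath.cat_src]

theorem occurs_of_occurs_evalMap {h : TipIndex T₀ V → TipIndex T₀ V →₀ PathAlgebra k V}
    {y : TipIndex T₀ V →₀ PathAlgebra k V} {r : TipIndex T₀ V} {p : QPath V}
    (hp : Occurs (evalMap h y) r p) :
    ∃ t w q, Occurs y t w ∧ Occurs (h t) r q ∧ q.tgt = w.src ∧ QPath.cat q w = p := by
  rw [Occurs, evalMap_apply, Finsupp.finsetSum_apply, coeff_sum] at hp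
  obtain ⟨t, -, ht⟩ := Finset.exists_ne_zero_of_sum_ne_zero hp
  rw [Finsupp.smul_apply, MulOpposite.smul_eq_mul_unop] at ht
  obtain ⟨q, w, hm, hq, hw⟩ := exists_of_coeff_mul_ne_zero ht
  obtain ⟨h1, h2⟩ := QPath.mul?_eq_some_iff.1 hm
  exact ⟨t, w, q, hw, hq, h1, h2⟩

theorem coeff_evalMap_single {h : TipIndex T₀ V → TipIndex T₀ V →₀ PathAlgebra k V}
    (t r : TipIndex T₀ V) (c : k) {q w : QPath V} (hq : q.tgt = w.src) :
    coeff (evalMap h (Finsupp.single t (c • ofPath k w)) r) (QPath.cat q w)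
      = c * coeff (h t r) q := by
  rw [evalMap_single, Finsupp.smul_apply, MulOpposite.smul_eq_mul_unop, unop_op, mul_smul_aux,
    coeff_smul, coeff_mul_ofPath _ (QPath.mul?_cat hq)]

end Eval

section Order

variable [LinearOrder T₀] [LinearOrder (QPath V)]

/-- `t u` is the largest basis element that occurs in `x`. -/
def IsLead (x : TipIndex T₀ V →₀ PathAlgebra k V) (t : TipIndex T₀ V) (u : QPath V) : Prop :=
  Occurs x t u ∧ ∀ t' u', Occurs x t' u' → t'.key u' ≤ t.key u

theorem exists_isLead {x : TipIndex T₀ V →₀ PathAlgebra k V} (hx : x ≠ 0) :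
    ∃ t u, IsLead x t u := by
  obtain ⟨t, u, h⟩ := exists_occurs hx
  obtain ⟨⟨t, u⟩, h1, h2⟩ := (finite_occurs x).exists_maximalFor
    (fun p : TipIndex T₀ V × QPath V => p.1.key p.2) _ ⟨(t, u), h⟩
  exact ⟨t, u, h1, fun t' u' h' => (le_total (t'.key u') (t.key u)).elim id
    fun hle => h2 (j := (t', u')) h' hle⟩

theorem IsLead.unique {T : Set (TipIndex T₀ V)} (hT : IsPrefixFree T)
    {x : TipIndex T₀ V →₀ PathAlgebra k V} (hx : IsSupportedOn T x)
    {t t' : TipIndex T₀ V} {u u' : QPath V} (h : IsLead x t u) (h' : IsLead x t' u') :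
    t = t' ∧ u = u' :=
  hT.key_injective (hx _ _ h.1).1 (hx _ _ h'.1).1 (hx _ _ h.1).2 (hx _ _ h'.1).2
    (le_antisymm (h'.2 _ _ h.1) (h.2 _ _ h'.1))

/-- The basic cancellation step: equal leading coefficients cancel, and by injectivity of `key` no
other term of the difference can occupy the leading position. -/
theorem key_lt_of_occurs_sub {T : Set (TipIndex T₀ V)} (hT : IsPrefixFree T)
    {x y : TipIndex T₀ V →₀ PathAlgebra k V} (hx : IsSupportedOn T x) (hy : IsSupportedOn T y)
    {t : TipIndex T₀ V} {u : QPath V} (h : IsLead x t u) (h' : IsLead y t u)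
    (e : coeff (x t) u = coeff (y t) u) {t' : TipIndex T₀ V} {u' : QPath V}
    (ho : Occurs (x - y) t' u') : t'.key u' < t.key u := by
  refine lt_of_le_of_ne (ho.of_sub.elim (h.2 _ _) (h'.2 _ _)) fun hk => ?_
  have hs := hx.sub hy _ _ ho
  obtain ⟨rfl, rfl⟩ := hT.key_injective hs.1 (hx _ _ h.1).1 hs.2 (hx _ _ h.1).2 hk
  simp [Occurs, e] at ho

theorem isLead_single_smul_ofPath (t : TipIndex T₀ V) {c : k} (hc : c ≠ 0) (w : QPath V) :
    IsLead (Finsupp.single t (c • ofPath k w)) t w := by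
  refine ⟨by simpa [Occurs] using hc, fun t' u' h => ?_⟩
  obtain ⟨rfl, rfl⟩ := occurs_single_smul_ofPath h
  exact le_rfl

theorem QPath.IsAdmissibleOrder.key_cat_le (hord : QPath.IsAdmissibleOrder V)
    {t t' : TipIndex T₀ V} {u u' w : QPath V} (hu : t.word.tgt = u.src)
    (hu' : t'.word.tgt = u'.src) (hw : u.tgt = w.src) (hw' : u'.tgt = w.src)
    (h : t.key u ≤ t'.key u') : t.key (QPath.cat u w) ≤ t'.key (QPath.cat u' w) := by
  rw [TipIndex.key_cat hu hw, TipIndex.key_cat hu' hw']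
  simp only [TipIndex.key, Prod.Lex.toLex_le_toLex, TipIndex.append] at h ⊢
  rcases h with h | ⟨h1, h2⟩
  · exact Or.inl (hord.cat_lt_cat_right (by rw [QPath.cat_tgt hu, hw])
      (by rw [QPath.cat_tgt hu', hw']) h)
  · exact Or.inr ⟨by rw [h1], h2⟩

end Order

end Vectors

/-! ### Lead families and division with remainder in the ideal -/

section Step

variable {k : Type w} {V : Type u} [Field k] [Quiver.{v} V] [Fintype V] {T₀ : Type*}
  [LinearOrder T₀] [LinearOrder (QPath V)]

/-- If `p = a s b` with `s` the tip of `g`, the witness is the component of `a g b` in the degree of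
`p`. Multiplication by `a` and `b` fixes the end points, and admissibility keeps `p` the largest
path. -/
theorem exists_mem_isTip_of_not_isReduced (hord : QPath.IsAdmissibleOrder V)
    {I : Ideal (PathAlgebra k V)} [I.IsTwoSided] (hI : IsHomogeneousRelationIdeal I)
    {G : Set (PathAlgebra k V)} (hG : IsGroebnerBasis I G) {p : QPath V}
    (hp : ¬ QPath.IsReduced (tipSet G) p) :
    ∃ z ∈ I, coeff z p ≠ 0 ∧
      ∀ q, coeff z q ≠ 0 → q ≤ p ∧ q.src = p.src ∧ q.tgt = p.tgt ∧ q.len = p.len := by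
  simp only [QPath.IsReduced, not_forall, not_not] at hp
  obtain ⟨s, ⟨g, hg, hs, hmax⟩, hd⟩ := hp
  obtain ⟨a, b, ha, hb, rfl⟩ := QPath.dvd_iff.1 hd
  have hab : (QPath.cat a s).tgt = b.src := by rw [QPath.cat_tgt ha, hb]
  have hm : ofPath k a * g * ofPath k b ∈ I :=
    I.mul_mem_right _ (I.mul_mem_left _ (hG.1 hg))
  refine ⟨component (QPath.cat (QPath.cat a s) b).len (ofPath k a * g * ofPath k b),
    hI.component_mem _ hm _, ?_, ?_⟩
  · rw [coeff_component, if_pos rfl, coeff_mul_ofPath _ (QPath.mul?_cat hab),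
      coeff_ofPath_mul _ (QPath.mul?_cat ha)]
    exact hs
  · intro q hq
    rw [coeff_component] at hq
    obtain ⟨hl, hq⟩ := ite_ne_right_iff.1 hq
    obtain ⟨r, b', hm1, hr, hb'⟩ := exists_of_coeff_mul_ne_zero hq
    obtain ⟨a', s', hm2, ha', hs'⟩ := exists_of_coeff_mul_ne_zero hr
    obtain rfl := eq_of_coeff_ofPath_ne_zero hb'
    obtain rfl := eq_of_coeff_ofPath_ne_zero ha'
    refine ⟨hord.mul_right _ _ _ _ _ (hord.mul_left _ _ _ _ _ (hmax s' hs') (QPath.mul?_cat ha) hm2)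
      (QPath.mul?_cat hab) hm1, ?_, ?_, hl⟩
    · rw [QPath.mul?_eq_some_iff] at hm1 hm2
      rw [← hm1.2, ← hm2.2]
      simp
    · rw [QPath.mul?_eq_some_iff] at hm1
      rw [← hm1.2, QPath.cat_tgt hm1.1, QPath.cat_tgt hab]

/-- A vector whose leading term is not reduced can be made smaller modulo `I`. -/
theorem exists_ideal_reduction (deg : T₀ → ℤ) (hord : QPath.IsAdmissibleOrder V)
    {I : Ideal (PathAlgebra k V)} [I.IsTwoSided] (hI : IsHomogeneousRelationIdeal I)
    {G : Set (PathAlgebra k V)} (hG : IsGroebnerBasis I G) {T : Set (TipIndex T₀ V)}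
    (hT : IsPrefixFree T) {x : TipIndex T₀ V →₀ PathAlgebra k V} (hxs : IsSupportedOn T x)
    {r : TipIndex T₀ V} {p : QPath V} (hl : IsLead x r p)
    (hred : ¬ QPath.IsReduced (tipSet G) p) :
    ∃ z : TipIndex T₀ V →₀ PathAlgebra k V, IsSupportedOn T z ∧ (∀ t, z t ∈ I) ∧
      ∀ r' p', Occurs (x - z) r' p' → r'.key p' < r.key p ∧
        (Occurs x r' p' ∨ r'.cls deg p' = r.cls deg p) := by
  obtain ⟨hr, hp⟩ := hxs r p hl.1
  obtain ⟨z, hz, hz0, hzm⟩ := exists_mem_isTip_of_not_isReduced hord hI hG hred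
  set c := coeff (x r) p / coeff z p with hc
  have hzs : IsSupportedOn T (Finsupp.single r (c • z)) := by
    -- The paths in `z` share the source of `p`, so `z` can be placed at `r` without leaving the
    -- module.
    refine isSupportedOn_single hr fun u hu => ?_
    rw [coeff_smul] at hu
    rw [(hzm u (right_ne_zero_of_mul hu)).2.1, hp]
  have hcz : c • z ∈ I := by
    rw [Algebra.smul_def]
    exact I.mul_mem_left _ hz
  have hzI : ∀ t, (Finsupp.single r (c • z) : TipIndex T₀ V →₀ PathAlgebra k V) t ∈ I := by
    intro t
    by_cases e : r = t
    · subst e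
      simpa using hcz
    · simp [e]
  have hzl : IsLead (Finsupp.single r (c • z)) r p := by
    refine ⟨occurs_single_iff.2 ⟨rfl, ?_⟩, fun t' u' ho => ?_⟩
    · rw [coeff_smul]
      exact mul_ne_zero (div_ne_zero hl.1 hz0) hz0
    · obtain ⟨rfl, hu⟩ := occurs_single_iff.1 ho
      rw [coeff_smul] at hu
      obtain ⟨h1, h2, -⟩ := hzm u' (right_ne_zero_of_mul hu)
      refine Prod.Lex.toLex_mono ⟨?_, le_rfl⟩
      exact (hord.cat_le_cat_left_iff (by rw [hp, h2]) hp).2 h1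
  refine ⟨_, hzs, hzI, fun r' p' ho => ⟨key_lt_of_occurs_sub hT hxs hzs hl hzl ?_ ho, ?_⟩⟩
  · simp [hc, div_mul_cancel₀ _ hz0]
  · refine ho.of_sub.imp_right fun ho => ?_
    obtain ⟨rfl, hu⟩ := occurs_single_iff.1 ho
    rw [coeff_smul] at hu
    obtain ⟨-, -, h3, h4⟩ := hzm p' (right_ne_zero_of_mul hu)
    simp only [TipIndex.cls, h3, h4]

/-- `T'` consists of leading terms of vectors `h t` supported on `T`, one for each `t ∈ T'`. -/
structure IsLeadFamily (deg : T₀ → ℤ) (T T' : Set (TipIndex T₀ V))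
    (h : TipIndex T₀ V → TipIndex T₀ V →₀ PathAlgebra k V) : Prop where
  prefixFree : IsPrefixFree T
  prefixFree' : IsPrefixFree T'
  eq_zero : ∀ t ∉ T', h t = 0
  supp : ∀ t ∈ T', IsSupportedOn T (h t)
  lead : ∀ t ∈ T', ∃ r ∈ T, r.word.tgt = t.tail.src ∧ r.append t.tail = t ∧ IsLead (h t) r t.tail
  cls : ∀ t ∈ T', ∀ r p, Occurs (h t) r p →
    r.cls deg p = (deg t.place + t.word.len, t.word.tgt)

namespace IsLeadFamily

variable {deg : T₀ → ℤ} {T T' : Set (TipIndex T₀ V)}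
  {h : TipIndex T₀ V → TipIndex T₀ V →₀ PathAlgebra k V}

theorem tail_tgt (H : IsLeadFamily deg T T' h) {t : TipIndex T₀ V} (ht : t ∈ T') :
    t.tail.tgt = t.word.tgt := by
  obtain ⟨r, -, h1, h2, -⟩ := H.lead t ht
  rw [← h2]
  exact (QPath.cat_tgt h1).symm

/-- A term of `h t` times `w` is bounded by the leading term `r t.tail` times `w`, whose position is
that of `t w`. Homogeneity of `h t` carries the degree and the target along. -/
theorem exists_of_occurs_evalMap (H : IsLeadFamily deg T T' h) (hord : QPath.IsAdmissibleOrder V)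
    {y : TipIndex T₀ V →₀ PathAlgebra k V} (hy : IsSupportedOn T' y) {r : TipIndex T₀ V}
    {p : QPath V} (hp : Occurs (evalMap h y) r p) :
    ∃ t w, Occurs y t w ∧ r.key p ≤ t.key w ∧ r.cls deg p = t.cls deg w ∧ r ∈ T ∧
      r.word.tgt = p.src := by
  obtain ⟨t, w, q, h1, h2, h3, rfl⟩ := occurs_of_occurs_evalMap hp
  obtain ⟨ht, hw⟩ := hy t w h1
  obtain ⟨r₀, hr₀, h4, h5, h6⟩ := H.lead t ht
  obtain ⟨hr, hq⟩ := H.supp t ht r q h2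
  have hw' : t.tail.tgt = w.src := by rw [H.tail_tgt ht, hw]
  refine ⟨t, w, h1, ?_, ?_, hr, by simpa using hq⟩
  · rw [← TipIndex.key_tail h4 h5 hw']
    exact hord.key_cat_le hq h4 h3 hw' (h6.2 r q h2)
  · have := congrArg Prod.fst (H.cls t ht r q h2)
    simp only [TipIndex.cls] at this ⊢
    rw [QPath.len_cat h3, QPath.cat_tgt h3]
    simp only [Prod.mk.injEq, and_true]
    push_cast
    linarith

theorem isSupportedOn_evalMap (H : IsLeadFamily deg T T' h) (hord : QPath.IsAdmissibleOrder V)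
    {y : TipIndex T₀ V →₀ PathAlgebra k V} (hy : IsSupportedOn T' y) :
    IsSupportedOn T (evalMap h y) := by
  intro r p hp
  obtain ⟨t, w, -, -, -, h1⟩ := H.exists_of_occurs_evalMap hord hy hp
  exact h1

/-- The leading terms of the vectors `h t` cannot cancel each other: their multiples sit at the
positions `t.key w`, which are pairwise distinct because `T'` is prefix-free. So `h` behaves like a
right Gröbner basis over the path algebra. -/
theorem isLead_evalMap (H : IsLeadFamily deg T T' h) (hord : QPath.IsAdmissibleOrder V)
    {y : TipIndex T₀ V →₀ PathAlgebra k V} (hy : IsSupportedOn T' y) {t : TipIndex T₀ V}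
    {w : QPath V} (hl : IsLead y t w) :
    ∃ r ∈ T, r.word.tgt = t.tail.src ∧ r.append t.tail = t ∧ IsLead (h t) r t.tail ∧
      IsLead (evalMap h y) r (QPath.cat t.tail w) := by
  obtain ⟨ht, hw⟩ := hy t w hl.1
  obtain ⟨r, hr, h4, h5, h6⟩ := H.lead t ht
  have hw' : t.tail.tgt = w.src := by rw [H.tail_tgt ht, hw]
  refine ⟨r, hr, h4, h5, h6, ?_, ?_⟩
  · set c := coeff (y t) w with hc
    have hs := isSupportedOn_single_smul_ofPath ht c hw
    have e : evalMap h y = evalMap h (Finsupp.single t (c • ofPath k w))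
        + evalMap h (y - Finsupp.single t (c • ofPath k w)) := by
      rw [map_sub]
      abel
    -- Once its leading term is removed, `y` has only terms below `t w`, and so has the image of
    -- what remains.
    have h0 : coeff (evalMap h (y - Finsupp.single t (c • ofPath k w)) r)
        (QPath.cat t.tail w) = 0 := by
      by_contra hne
      obtain ⟨t', w', ho, hk, -⟩ := H.exists_of_occurs_evalMap hord (hy.sub hs) hne
      refine (hk.trans_lt (key_lt_of_occurs_sub H.prefixFree' hy hs hl
        (isLead_single_smul_ofPath t hl.1 w) ?_ ho)).ne (TipIndex.key_tail h4 h5 hw')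
      simp [← hc]
    rw [Occurs, e, Finsupp.add_apply, coeff_add, h0, add_zero, coeff_evalMap_single t r c hw']
    exact mul_ne_zero hl.1 h6.1
  · intro r' p' hp'
    obtain ⟨t', w', ho, hk, -⟩ := H.exists_of_occurs_evalMap hord hy hp'
    rw [TipIndex.key_tail h4 h5 hw']
    exact hk.trans (hl.2 _ _ ho)

end IsLeadFamily

/-- A step in the construction of the resolution: `h` is a lead family in the submodule `K`, and
generates it up to vectors with entries in `I`. -/
structure IsResolutionStep (deg : T₀ → ℤ) (I : Ideal (PathAlgebra k V)) (S : Set (QPath V))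
    (T : Set (TipIndex T₀ V))
    (K : Submodule (PathAlgebra k V)ᵐᵒᵖ (TipIndex T₀ V →₀ PathAlgebra k V))
    (T' : Set (TipIndex T₀ V)) (h : TipIndex T₀ V → TipIndex T₀ V →₀ PathAlgebra k V) : Prop
    extends IsLeadFamily deg T T' h where
  supp_ker : ∀ x ∈ K, IsSupportedOn T x
  ideal_mem : ∀ z, IsSupportedOn T z → (∀ r, z r ∈ I) → z ∈ K
  mem_ker : ∀ t ∈ T', h t ∈ K
  tail_reduced : ∀ t ∈ T', QPath.IsReduced S t.tail
  -- Only reduced leading terms have to be reached by `T'`; the others are cancelled by vectors with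
  -- entries in `I`, which lie in `K` by `ideal_mem`.
  complete : ∀ x ∈ K, ∀ r p, IsLead x r p → QPath.IsReduced S p →
    ∃ t ∈ T', ∃ w, t.word.tgt = w.src ∧ t.key w = r.key p

namespace IsResolutionStep

variable {deg : T₀ → ℤ} {T T' : Set (TipIndex T₀ V)} {I : Ideal (PathAlgebra k V)} [I.IsTwoSided]
  {G : Set (PathAlgebra k V)}
  {K : Submodule (PathAlgebra k V)ᵐᵒᵖ (TipIndex T₀ V →₀ PathAlgebra k V)}
  {h : TipIndex T₀ V → TipIndex T₀ V →₀ PathAlgebra k V}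

/-- One division step. A reduced leading term is cancelled by a multiple of some `h t`, a
non-reduced one by a vector over `I`. In both cases the remainder stays in `K` and acquires no new
degrees or targets. -/
theorem exists_reduction (H : IsResolutionStep deg I (tipSet G) T K T' h)
    (hord : QPath.IsAdmissibleOrder V)
    (hI : IsHomogeneousRelationIdeal I) (hG : IsGroebnerBasis I G)
    {x : TipIndex T₀ V →₀ PathAlgebra k V} (hx : x ∈ K) {r : TipIndex T₀ V} {p : QPath V}
    (hl : IsLead x r p) :
    ∃ y : TipIndex T₀ V →₀ PathAlgebra k V, IsSupportedOn T' y ∧ (∀ t w, Occurs y t w → t.key w = r.key p ∧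
        t.cls deg w = r.cls deg p) ∧
      ∃ z : TipIndex T₀ V →₀ PathAlgebra k V, (∀ t, z t ∈ I) ∧ x - (evalMap h y + z) ∈ K ∧
        ∀ r' p', Occurs (x - (evalMap h y + z)) r' p' → r'.key p' < r.key p ∧
          (Occurs x r' p' ∨ r'.cls deg p' = r.cls deg p) := by
  have hxs := H.supp_ker x hx
  obtain ⟨hr, hp⟩ := hxs r p hl.1
  by_cases hred : QPath.IsReduced (tipSet G) p
  · obtain ⟨t, ht, w, hw, hk⟩ := H.complete x hx r p hl hred
    have hw' : t.tail.tgt = w.src := by rw [H.tail_tgt ht, hw]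
    obtain ⟨r', hr', h4, h5, h6⟩ := H.lead t ht
    have hk' := hk
    rw [← TipIndex.key_tail h4 h5 hw'] at hk'
    -- The leading term of `x` and the term `t.tail w` at `r'` occupy the same position, hence
    -- coincide.
    obtain ⟨rfl, rfl⟩ := H.prefixFree.key_injective hr' hr (by simpa using h4) hp hk'
    set c := coeff (x r') (QPath.cat t.tail w) / coeff (h t r') t.tail with hc
    have hc0 : c ≠ 0 := div_ne_zero hl.1 h6.1
    have hys := isSupportedOn_single_smul_ofPath ht c hw
    have hyl := isLead_single_smul_ofPath (k := k) t hc0 w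
    have hcls : t.cls deg w = r'.cls deg (QPath.cat t.tail w) := by
      conv_lhs => rw [← h5]
      simp only [TipIndex.cls, TipIndex.append]
      rw [QPath.len_cat hw', QPath.len_cat h4, QPath.cat_tgt hw']
      push_cast
      ring_nf
    refine ⟨_, hys, ?_, 0, fun t => I.zero_mem, ?_, ?_⟩
    · intro t' w' ho
      obtain ⟨rfl, rfl⟩ := occurs_single_smul_ofPath ho
      exact ⟨hk, hcls⟩
    · rw [add_zero, evalMap_single]
      exact K.sub_mem hx (K.smul_mem _ (H.mem_ker t ht))
    · rw [add_zero]
      intro r'' p'' ho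
      constructor
      · obtain ⟨r₁, hr₁, h7, h8, -, h9⟩ := H.isLead_evalMap hord hys hyl
        obtain ⟨rfl, -⟩ := H.prefixFree.key_injective hr₁ hr' (by simpa using h7)
          (by simpa using h4) (u := QPath.cat t.tail w) (u' := QPath.cat t.tail w)
          (by rw [TipIndex.key_tail h7 h8 hw', TipIndex.key_tail h4 h5 hw'])
        refine key_lt_of_occurs_sub H.prefixFree hxs (H.isSupportedOn_evalMap hord hys) hl h9 ?_ ho
        rw [coeff_evalMap_single _ _ _ hw', hc, div_mul_cancel₀ _ h6.1]
      · refine ho.of_sub.imp_right fun ho => ?_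
        obtain ⟨t', w', ho', -, hcl, -⟩ := H.exists_of_occurs_evalMap hord hys ho
        obtain ⟨rfl, rfl⟩ := occurs_single_smul_ofPath ho'
        rw [hcl, hcls]
  · obtain ⟨z, hz, hzI, hlt⟩ := exists_ideal_reduction deg hord hI hG H.prefixFree hxs hl hred
    refine ⟨0, fun t u ho => absurd ho not_occurs_zero, fun t u ho => absurd ho not_occurs_zero,
      z, hzI, ?_, ?_⟩
    · rw [map_zero, zero_add]
      exact K.sub_mem hx (H.ideal_mem _ hz hzI)
    · rwa [map_zero, zero_add]

/-- Reduction is iterated by well-founded induction on a bound `κ` for the positions; finiteness of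
`T₀` makes the lexicographic order a well-order. The set `C` records that homogeneity survives, and
the bound on `y` keeps corrections below a prescribed leading term. -/
theorem exists_division [Finite T₀] [WellFoundedLT (QPath V)]
    (H : IsResolutionStep deg I (tipSet G) T K T' h)
    (hord : QPath.IsAdmissibleOrder V)
    (hI : IsHomogeneousRelationIdeal I) (hG : IsGroebnerBasis I G) (C : Set (ℤ × V))
    (κ : QPath V ×ₗ T₀) (x : TipIndex T₀ V →₀ PathAlgebra k V) (hx : x ∈ K)
    (hκ : ∀ r p, Occurs x r p → r.key p ≤ κ ∧ r.cls deg p ∈ C) :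
    ∃ y : TipIndex T₀ V →₀ PathAlgebra k V, IsSupportedOn T' y ∧ (∀ t w, Occurs y t w → t.key w ≤ κ ∧ t.cls deg w ∈ C) ∧
      ∀ t, (x - evalMap h y) t ∈ I := by
  induction κ using WellFoundedLT.induction generalizing x with
  | ind κ ih =>
  by_cases h0 : x = 0
  · refine ⟨0, fun t u ho => absurd ho not_occurs_zero, fun t u ho => absurd ho not_occurs_zero, ?_⟩
    simp [h0]
  obtain ⟨r, p, hl⟩ := exists_isLead h0
  obtain ⟨hle, hC⟩ := hκ r p hl.1
  obtain ⟨y, hy, hy', z, hz, hm, hlt⟩ := H.exists_reduction hord hI hG hx hl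
  have hyκ : ∀ t w, Occurs y t w → t.key w ≤ κ ∧ t.cls deg w ∈ C := fun t w ho => by
    rw [(hy' t w ho).1, (hy' t w ho).2]
    exact ⟨hle, hC⟩
  by_cases h1 : x - (evalMap h y + z) = 0
  · refine ⟨y, hy, hyκ, fun t => ?_⟩
    rw [sub_eq_zero.1 h1, add_sub_cancel_left]
    exact hz t
  obtain ⟨r', p', hl'⟩ := exists_isLead h1
  have hκ' := (hlt r' p' hl'.1).1.trans_le hle
  obtain ⟨y₁, h2, h3, h4⟩ := ih (r'.key p') hκ' _ hm fun r₁ p₁ ho => ⟨hl'.2 _ _ ho,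
    (hlt r₁ p₁ ho).2.elim (fun ho => (hκ _ _ ho).2) fun e => e ▸ hC⟩
  refine ⟨y + y₁, hy.add h2, fun t w ho => ho.of_add.elim (hyκ t w) fun ho => ?_, fun t => ?_⟩
  · exact ⟨(h3 t w ho).1.trans hκ'.le, (h3 t w ho).2⟩
  · have e : x - evalMap h (y + y₁) = (x - (evalMap h y + z) - evalMap h y₁) + z := by
      rw [map_add]
      abel
    rw [e]
    exact I.add_mem (h4 t) (hz t)

end IsResolutionStep

end Step

theorem QPath.exists_minimal_left_factor {V : Type u} [Quiver.{v} V] (P : QPath V → Prop)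
    (p : QPath V) (hp : P p) :
    ∃ u w : QPath V, u.tgt = w.src ∧ QPath.cat u w = p ∧ P u ∧
      ∀ u₁ u₂ : QPath V, u₁.tgt = u₂.src → QPath.cat u₁ u₂ = u → 0 < u₂.len → ¬ P u₁ := by
  induction hn : p.len using Nat.strong_induction_on generalizing p with
  | _ n ih =>
  by_cases h : ∃ u₁ u₂ : QPath V, u₁.tgt = u₂.src ∧ QPath.cat u₁ u₂ = p ∧ 0 < u₂.len ∧ P u₁
  · obtain ⟨u₁, u₂, h1, rfl, h2, h3⟩ := h
    have hlen := QPath.len_cat h1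
    obtain ⟨u, w, h4, rfl, h5⟩ := ih u₁.len (by omega) u₁ h3 rfl
    rw [QPath.cat_tgt h4] at h1
    exact ⟨u, QPath.cat w u₂, by simpa using h4, (QPath.cat_assoc h4 h1).symm, h5⟩
  · push Not at h
    exact ⟨p, QPath.vertex p.tgt, rfl, QPath.cat_vertex rfl, hp, h⟩

theorem exists_seq_of_forall_exists {α : Type*} (P : ℕ → α → Prop) (R : ℕ → α → α → Prop) {a : α}
    (ha : P 0 a) (h : ∀ n a, P n a → ∃ b, P (n + 1) b ∧ R n a b) :
    ∃ f : ℕ → α, f 0 = a ∧ ∀ n, R n (f n) (f (n + 1)) := by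
  choose! g hg hR using h
  let f : ℕ → α := fun n => Nat.rec a (fun n b => g n b) n
  have hf : ∀ n, P n (f n) := by
    intro n
    induction n with
    | zero => exact ha
    | succ n ih => exact hg n _ ih
  exact ⟨f, rfl, fun n => hR n _ (hf n)⟩

/-! ### Construction of the successive generators -/

section Chains

variable {k : Type w} {V : Type u} [Field k] [Quiver.{v} V] {T₀ : Type*}

/-- The indices obtained from those in `T` by appending a minimal path that makes the last syllable
divisible by an element of `S`. -/
def nextSet (S : Set (QPath V)) (T : Set (TipIndex T₀ V)) : Set (TipIndex T₀ V) :=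
  {t | ∃ r ∈ T, r.word.tgt = t.tail.src ∧ r.append t.tail = t ∧ QPath.IsReduced S t.tail ∧
    ¬ QPath.IsReduced S (QPath.cat r.tail t.tail) ∧
    ∀ u₁ u₂ : QPath V, u₁.tgt = u₂.src → QPath.cat u₁ u₂ = t.tail → 0 < u₂.len →
      QPath.IsReduced S (QPath.cat r.tail u₁)}

/-- The indices of the generators of the successive modules in the resolution. -/
def chainSet (S : Set (QPath V)) (T : Set (TipIndex T₀ V)) : ℕ → Set (TipIndex T₀ V)
  | 0 => T
  | n + 1 => nextSet S (chainSet S T n)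

/-- If one word is a left factor of another, prefix-freeness of `T` shows that both extend the same
`r`. Then one tail is a left factor of the other, and minimality of the longer tail excludes a
proper one. -/
theorem IsPrefixFree.nextSet {S : Set (QPath V)} {T : Set (TipIndex T₀ V)} (hT : IsPrefixFree T) :
    IsPrefixFree (nextSet S T) := by
  rintro t ⟨r, hr, h1, h2, -, h3, -⟩ t' ⟨r', hr', h1', h2', -, -, h3'⟩ hp hd
  obtain ⟨x, hx, e⟩ := QPath.dvdLeft_iff.1 hd
  have hx' : t.tail.tgt = x.src := by
    rw [← hx, ← h2]
    exact (QPath.cat_tgt h1).symm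
  have hk : r.key (QPath.cat t.tail x) = r'.key t'.tail := by
    rw [TipIndex.key_cat h1 hx', h2]
    simp only [TipIndex.key, hp, e]
    rw [← h2']
    rfl
  obtain ⟨rfl, e'⟩ := hT.key_injective hr hr' (by simpa using h1) h1' hk
  rcases Nat.eq_zero_or_pos x.len with h0 | h0
  · rw [QPath.cat_of_len_eq_zero hx' h0] at e'
    rw [← h2, ← h2', e']
  · exact absurd (h3' _ _ hx' e' h0) h3

variable [Fintype V] {T' : Set (TipIndex T₀ V)}
  {h : TipIndex T₀ V → TipIndex T₀ V →₀ PathAlgebra k V}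

/-- The vectors supported on `T'` that `h` sends to vectors with entries in `I`. -/
def stepKernel (I : Ideal (PathAlgebra k V)) [I.IsTwoSided] (T' : Set (TipIndex T₀ V))
    (h : TipIndex T₀ V → TipIndex T₀ V →₀ PathAlgebra k V) :
    Submodule (PathAlgebra k V)ᵐᵒᵖ (TipIndex T₀ V →₀ PathAlgebra k V) where
  carrier := {y | IsSupportedOn T' y ∧ ∀ r, evalMap h y r ∈ I}
  add_mem' {x y} hx hy := ⟨hx.1.add hy.1, fun r => by
    rw [map_add]
    exact I.add_mem (hx.2 r) (hy.2 r)⟩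
  zero_mem' := ⟨fun t u ho => absurd ho not_occurs_zero, by simp⟩
  smul_mem' c x hx := ⟨hx.1.smul c, fun r => by
    rw [map_smul, Finsupp.smul_apply, MulOpposite.smul_eq_mul_unop]
    exact I.mul_mem_right _ (hx.2 r)⟩

variable [LinearOrder T₀] [LinearOrder (QPath V)] {deg : T₀ → ℤ} {T : Set (TipIndex T₀ V)}
  {I : Ideal (PathAlgebra k V)} [I.IsTwoSided] {G : Set (PathAlgebra k V)}
  {K : Submodule (PathAlgebra k V)ᵐᵒᵖ (TipIndex T₀ V →₀ PathAlgebra k V)}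

/-- Within one index, positions compare the cofactors, since an admissible order allows left
cancellation. -/
theorem IsLead.isTip (hord : QPath.IsAdmissibleOrder V)
    {x : TipIndex T₀ V →₀ PathAlgebra k V} (hx : IsSupportedOn T x) {r : TipIndex T₀ V}
    {p : QPath V} (hl : IsLead x r p) : IsTip (x r) p := by
  refine ⟨hl.1, fun q hq => ?_⟩
  have h2 := hl.2 r q hq
  simp only [TipIndex.key, Prod.Lex.toLex_le_toLex, le_refl, and_true] at h2
  rw [← le_iff_lt_or_eq] at h2
  exact (hord.cat_le_cat_left_iff (hx r q hq).2 (hx r p hl.1).2).1 h2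

/-- The image of `y` has leading term `t.tail w` at some `r`. This is the tip of an entry lying in
`I`, so the Gröbner property applies. -/
theorem IsLeadFamily.not_isReduced_of_isLead (H : IsLeadFamily deg T T' h)
    (hord : QPath.IsAdmissibleOrder V) (hG : IsGroebnerBasis I G)
    {y : TipIndex T₀ V →₀ PathAlgebra k V} (hy : y ∈ stepKernel I T' h) {t : TipIndex T₀ V}
    {w : QPath V} (hl : IsLead y t w) : ¬ QPath.IsReduced (tipSet G) (QPath.cat t.tail w) := by
  obtain ⟨r, -, -, -, -, hl'⟩ := H.isLead_evalMap hord hy.1 hl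
  obtain ⟨s, hs, hd⟩ := hG.2 _ (hy.2 r) _ (hl'.isTip hord (H.isSupportedOn_evalMap hord hy.1))
  exact fun hr => hr s hs hd

/-- The image of the monomial `t w` has a non-reduced leading term, which an element of `I` removes.
The smaller remainder is divided by the family, and subtracting the quotient corrects `t w` to a
cycle modulo `I` without touching its leading term. -/
theorem IsResolutionStep.exists_mem_stepKernel [Finite T₀] [WellFoundedLT (QPath V)]
    (H : IsResolutionStep deg I (tipSet G) T K T' h) (hord : QPath.IsAdmissibleOrder V)
    (hI : IsHomogeneousRelationIdeal I) (hG : IsGroebnerBasis I G) {t : TipIndex T₀ V}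
    (ht : t ∈ T') {w : QPath V} (hw : t.word.tgt = w.src)
    (hred : ¬ QPath.IsReduced (tipSet G) (QPath.cat t.tail w)) :
    ∃ y ∈ stepKernel I T' h, IsLead y t w ∧ ∀ t' w', Occurs y t' w' →
      t'.cls deg w' = t.cls deg w := by
  set y : TipIndex T₀ V →₀ PathAlgebra k V := Finsupp.single t ((1 : k) • ofPath k w) with hy
  have hys : IsSupportedOn T' y := isSupportedOn_single_smul_ofPath ht 1 hw
  have hyl : IsLead y t w := isLead_single_smul_ofPath t one_ne_zero w
  have hycls : ∀ t' w', Occurs y t' w' → t'.cls deg w' = t.cls deg w := fun t' w' ho => by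
    obtain ⟨rfl, rfl⟩ := occurs_single_smul_ofPath ho
    rfl
  have hxK : evalMap h y ∈ K := by
    rw [hy, evalMap_single]
    exact K.smul_mem _ (H.mem_ker t ht)
  have hw' : t.tail.tgt = w.src := by rw [H.tail_tgt ht, hw]
  obtain ⟨r, hr, h4, h5, -, hl⟩ := H.isLead_evalMap hord hys hyl
  have hk := TipIndex.key_tail h4 h5 hw'
  obtain ⟨z, hz, hzI, hlt⟩ := exists_ideal_reduction deg hord hI hG H.prefixFree
    (H.supp_ker _ hxK) hl hred
  have hcls : ∀ r' p', Occurs (evalMap h y) r' p' → r'.cls deg p' = t.cls deg w := by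
    intro r' p' ho
    obtain ⟨t', w', ho', -, e, -⟩ := H.exists_of_occurs_evalMap hord hys ho
    rw [e, hycls _ _ ho']
  by_cases h0 : evalMap h y - z = 0
  · refine ⟨y, ⟨hys, fun r => ?_⟩, hyl, hycls⟩
    rw [sub_eq_zero.1 h0]
    exact hzI r
  obtain ⟨r', p', hl'⟩ := exists_isLead h0
  obtain ⟨y₁, hy₁, hy₁', hdiv⟩ := H.exists_division hord hI hG {t.cls deg w} (r'.key p') _
    (K.sub_mem hxK (H.ideal_mem z hz hzI)) fun r₁ p₁ ho => ⟨hl'.2 _ _ ho,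
      (hlt _ _ ho).2.elim (hcls _ _) fun e => e.trans (hcls _ _ hl.1)⟩
  -- Positions in `y₁` are bounded by the leading position of the remainder, which is strictly below
  -- that of `t w`.
  have hlt' : r'.key p' < t.key w := by
    rw [← hk]
    exact (hlt _ _ hl'.1).1
  have hno : ¬ Occurs y₁ t w := fun ho => ((hy₁' t w ho).1.trans_lt hlt').false
  refine ⟨y - y₁, ⟨hys.sub hy₁, fun r => ?_⟩, ⟨?_, fun t' w' ho => ?_⟩, fun t' w' ho => ?_⟩
  · have e : evalMap h (y - y₁) = (evalMap h y - z - evalMap h y₁) + z := by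
      rw [map_sub]
      abel
    rw [e]
    exact I.add_mem (hdiv r) (hzI r)
  · rw [Occurs, not_not] at hno
    have := hyl.1
    rw [Occurs] at this
    rw [Occurs, Finsupp.sub_apply, coeff_sub, hno, sub_zero]
    exact this
  · exact ho.of_sub.elim (hyl.2 _ _) fun ho => ((hy₁' _ _ ho).1.trans_lt hlt').le
  · exact ho.of_sub.elim (hycls _ _) fun ho => (hy₁' _ _ ho).2

/-- The new vectors are cycles with prescribed leading terms. They suffice because the leading term
of any cycle is non-reduced after the previous tail, and hence has a minimal left factor with this
property. -/
theorem IsResolutionStep.exists_next [Finite T₀] [WellFoundedLT (QPath V)]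
    (H : IsResolutionStep deg I (tipSet G) T K T' h) (hord : QPath.IsAdmissibleOrder V)
    (hI : IsHomogeneousRelationIdeal I) (hG : IsGroebnerBasis I G) :
    ∃ h', IsResolutionStep deg I (tipSet G) T' (stepKernel I T' h) (nextSet (tipSet G) T') h' := by
  have key : ∀ t ∈ nextSet (tipSet G) T', ∃ x ∈ stepKernel I T' h,
      (∃ r ∈ T', r.word.tgt = t.tail.src ∧ r.append t.tail = t ∧ IsLead x r t.tail) ∧
      ∀ r p, Occurs x r p → r.cls deg p = (deg t.place + t.word.len, t.word.tgt) := by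
    rintro t ⟨r, hr, h1, h2, -, h3, -⟩
    obtain ⟨y, hy, hl, hc⟩ := H.exists_mem_stepKernel hord hI hG hr h1 h3
    refine ⟨y, hy, ⟨r, hr, h1, h2, hl⟩, fun r' p' ho => (hc r' p' ho).trans ?_⟩
    conv_rhs => rw [← h2]
    simp only [TipIndex.cls, TipIndex.append]
    rw [QPath.len_cat h1, QPath.cat_tgt h1]
    push_cast
    ring_nf
  choose! f hf hlead hcls using key
  refine ⟨fun t => if t ∈ nextSet (tipSet G) T' then f t else 0, ?_⟩
  refine ⟨⟨H.prefixFree', H.prefixFree'.nextSet, fun t ht => if_neg ht, ?_, ?_, ?_⟩, ?_, ?_, ?_,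
    ?_, ?_⟩
  · intro t ht
    rw [if_pos ht]
    exact (hf t ht).1
  · intro t ht
    rw [if_pos ht]
    exact hlead t ht
  · intro t ht
    rw [if_pos ht]
    exact hcls t ht
  · exact fun x hx => hx.1
  · intro z hz hzI
    refine ⟨hz, fun r => ?_⟩
    rw [evalMap_apply, Finsupp.finsetSum_apply]
    refine I.sum_mem fun t _ => ?_
    rw [Finsupp.smul_apply, MulOpposite.smul_eq_mul_unop]
    exact I.mul_mem_left _ (hzI t)
  · intro t ht
    rw [if_pos ht]
    exact hf t ht
  · rintro t ⟨r, -, -, -, h1, -⟩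
    exact h1
  · intro x hx r p hl hred
    obtain ⟨hr, hp⟩ := hx.1 _ _ hl.1
    -- The shortest left factor `u` of `p` that makes `r.tail u` non-reduced is the new tail; it is
    -- reduced because `p` is.
    obtain ⟨u, w, huw, rfl, h1, h2⟩ := QPath.exists_minimal_left_factor
      (fun u => ¬ QPath.IsReduced (tipSet G) (QPath.cat r.tail u)) p
      (H.not_isReduced_of_isLead hord hG hx hl)
    rw [QPath.cat_src] at hp
    refine ⟨r.append u, ⟨r, hr, hp, rfl, hred.left huw, h1, ?_⟩, w, ?_, ?_⟩
    · exact fun u₁ u₂ h3 h4 h5 => not_not.1 (h2 u₁ u₂ h3 h4 h5)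
    · rw [TipIndex.append, QPath.cat_tgt hp, huw]
    · exact (TipIndex.key_cat hp huw).symm

theorem IsResolutionStep.exists_resolution [Finite T₀] [WellFoundedLT (QPath V)]
    (H : IsResolutionStep deg I (tipSet G) T K T' h) (hord : QPath.IsAdmissibleOrder V)
    (hI : IsHomogeneousRelationIdeal I) (hG : IsGroebnerBasis I G) :
    ∃ f : ℕ → TipIndex T₀ V → TipIndex T₀ V →₀ PathAlgebra k V, f 0 = h ∧
      ∀ n, IsResolutionStep deg I (tipSet G) (chainSet (tipSet G) T' n)
        (stepKernel I (chainSet (tipSet G) T' n) (f n)) (chainSet (tipSet G) T' (n + 1))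
        (f (n + 1)) := by
  refine exists_seq_of_forall_exists
    (fun n f => ∃ T K, IsResolutionStep deg I (tipSet G) T K (chainSet (tipSet G) T' n) f)
    (fun n f f' => IsResolutionStep deg I (tipSet G) (chainSet (tipSet G) T' n)
        (stepKernel I (chainSet (tipSet G) T' n) f) (chainSet (tipSet G) T' (n + 1)) f')
    ⟨T, K, H⟩ ?_
  rintro n f ⟨T, K, hf⟩
  obtain ⟨f', hf'⟩ := hf.exists_next hord hI hG
  exact ⟨f', ⟨_, _, hf'⟩, hf'⟩

end Chains

/-! ### Homogeneous components -/

section GradedPart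

variable {M : Type*} [AddCommGroup M] {gr : ℤ → AddSubgroup M}

/-- The component of degree `j` of an element of a graded group. -/
def gradedPart (h : DirectSum.IsInternal gr) (j : ℤ) : M →+ M :=
  ((gr j).subtype.comp (DFinsupp.evalAddMonoidHom j)).comp
    (AddEquiv.ofBijective (DirectSum.coeAddMonoidHom gr) h).symm.toAddMonoidHom

theorem gradedPart_mem (h : DirectSum.IsInternal gr) (j : ℤ) (x : M) :
    gradedPart h j x ∈ gr j := SetLike.coe_mem _

theorem gradedPart_of_mem (h : DirectSum.IsInternal gr) {i : ℤ} {x : M} (hx : x ∈ gr i) (j : ℤ) :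
    gradedPart h j x = if i = j then x else 0 := by
  have e : (AddEquiv.ofBijective (DirectSum.coeAddMonoidHom gr) h).symm x
      = DirectSum.of (fun i => gr i) i ⟨x, hx⟩ := by
    rw [AddEquiv.symm_apply_eq]
    exact (DirectSum.coeAddMonoidHom_of gr i ⟨x, hx⟩).symm
  change (((AddEquiv.ofBijective (DirectSum.coeAddMonoidHom gr) h).symm x) j : M) = _
  rw [e, DirectSum.coe_of_apply]
  split_ifs <;> rfl

theorem gradedPart_self (h : DirectSum.IsInternal gr) {i : ℤ} {x : M} (hx : x ∈ gr i) :
    gradedPart h i x = x := by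
  rw [gradedPart_of_mem h hx, if_pos rfl]

theorem mem_of_forall_gradedPart_mem (h : DirectSum.IsInternal gr) {N : AddSubgroup M} {x : M}
    (hx : ∀ i, gradedPart h i x ∈ N) : x ∈ N := by
  have e : x = DirectSum.coeAddMonoidHom gr
      ((AddEquiv.ofBijective (DirectSum.coeAddMonoidHom gr) h).symm x) :=
    ((AddEquiv.ofBijective (DirectSum.coeAddMonoidHom gr) h).apply_symm_apply x).symm
  rw [e, DirectSum.coeAddMonoidHom_eq_dfinsuppSum, DFinsupp.sum]
  exact N.sum_mem fun i _ => hx i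

end GradedPart

/-! ### A graded Nakayama lemma for projective modules -/

section Nakayama

variable {k : Type w} {V : Type u} [Field k] [Quiver.{v} V] [Fintype V]
  {I : Ideal (PathAlgebra k V)} [I.IsTwoSided]

theorem mul_mem_algGrading {m n : ℕ} {a b : PathAlgebra k V ⧸ I} (ha : a ∈ algGrading I m)
    (hb : b ∈ algGrading I n) : a * b ∈ algGrading I (m + n) := by
  obtain ⟨x, hx, rfl⟩ := ha
  obtain ⟨y, hy, rfl⟩ := hb
  refine ⟨x * y, fun r hr => ?_, map_mul _ _ _⟩
  obtain ⟨p, q, hm, hp, hq⟩ := exists_of_coeff_mul_ne_zero hr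
  obtain ⟨h1, rfl⟩ := QPath.mul?_eq_some_iff.1 hm
  rw [QPath.len_cat h1, hx p hp, hy q hq]

theorem mk_smul_ofPath_mem_algGrading (c : k) (p : QPath V) :
    Ideal.Quotient.mk I (c • ofPath k p) ∈ algGrading I p.len := by
  refine ⟨_, fun q hq => ?_, rfl⟩
  rw [coeff_smul] at hq
  rw [eq_of_coeff_ofPath_ne_zero (right_ne_zero_of_mul hq)]

theorem one_mem_algGrading : (1 : PathAlgebra k V ⧸ I) ∈ algGrading I 0 := by
  refine ⟨1, fun q hq => ?_, map_one _⟩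
  rw [one_def, coeff_sum] at hq
  obtain ⟨a, -, ha⟩ := Finset.exists_ne_zero_of_sum_ne_zero hq
  rw [← eq_of_coeff_ofPath_ne_zero ha]
  rfl

theorem induction_on_algGrading {P : PathAlgebra k V ⧸ I → Prop} (a : PathAlgebra k V ⧸ I)
    (add : ∀ x y, P x → P y → P (x + y)) (hom : ∀ m, ∀ x ∈ algGrading I m, P x) : P a := by
  obtain ⟨x, rfl⟩ := Ideal.Quotient.mk_surjective a
  induction x using PathAlgebra.induction_on with
  | zero => exact hom 0 _ ⟨0, fun p hp => absurd rfl hp, rfl⟩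
  | add x y hx hy => exact add _ _ hx hy
  | single c p => exact hom _ _ (mk_smul_ofPath_mem_algGrading c p)

/-- An element of `A` that lies in `A_{≥ N}` for all `N` is zero. -/
theorem eq_zero_of_forall_le_len (hI : IsHomogeneousRelationIdeal I) {a : PathAlgebra k V ⧸ I}
    (h : ∀ N : ℕ, ∃ z, (∀ p, coeff z p ≠ 0 → N ≤ p.len) ∧ Ideal.Quotient.mk I z = a) : a = 0 := by
  obtain ⟨x, rfl⟩ := Ideal.Quotient.mk_surjective a
  have hc : ∀ n, component n x ∈ I := by
    intro n
    -- With `z` in lengths above `n`, the elements `x` and `x - z` have the same component of degree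
    -- `n`, and the latter lies in the homogeneous ideal `I`.
    obtain ⟨z, hz, e⟩ := h (n + 1)
    have h1 := hI.component_mem _ (Ideal.Quotient.eq.1 e.symm) n
    convert h1 using 1
    refine coeff_ext fun p => ?_
    rw [coeff_component, coeff_component, coeff_sub]
    split_ifs with hp
    · have : coeff z p = 0 := by
        by_contra hne
        have := hz p hne
        omega
      rw [this, sub_zero]
    · rfl
  rw [Ideal.Quotient.eq_zero_iff_mem]
  have e : x = ∑ n ∈ (finite_coeff x).toFinset.image QPath.len, component n x := by
    refine coeff_ext fun p => ?_
    simp only [coeff_sum, coeff_component, Finset.sum_ite_eq]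
    split_ifs with hp
    · rfl
    · by_contra hne
      exact hp (Finset.mem_image_of_mem _ ((finite_coeff x).mem_toFinset.2 hne))
  rw [e]
  exact I.sum_mem fun n _ => hc n

variable {M : Type*} [AddCommGroup M] [Module (PathAlgebra k V ⧸ I)ᵐᵒᵖ M]
  {gr : ℤ → AddSubgroup M}

/-- The sums of products `x a` of degree `j` of homogeneous elements with `deg a ≥ N`. -/
def productSpan (I : Ideal (PathAlgebra k V)) [I.IsTwoSided] {M : Type*} [AddCommGroup M]
    [Module (PathAlgebra k V ⧸ I)ᵐᵒᵖ M] (gr : ℤ → AddSubgroup M) (N : ℕ) (j : ℤ) : AddSubgroup M :=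
  AddSubgroup.closure {y | ∃ m, N ≤ m ∧ ∃ x ∈ gr (j - m), ∃ a ∈ algGrading I m, y = op a • x}

/-- The radical is spanned by products whose module factor need not be homogeneous. Splitting the
module factor and the scalars into homogeneous pieces shows that each component is a sum of products
of homogeneous factors with a positive algebra degree. -/
theorem gradedPart_mem_productSpan (h : IsGradedModule I gr) {x : M} (hx : x ∈ radSubmodule I M)
    (j : ℤ) : gradedPart h.isInternal j x ∈ productSpan I gr 1 j := by
  have key : ∀ (b : PathAlgebra k V ⧸ I) (m : ℕ), 0 < m → ∀ a ∈ algGrading I m, ∀ (i : ℤ),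
      ∀ y ∈ gr i, gradedPart h.isInternal j (op b • op a • y) ∈ productSpan I gr 1 j := by
    intro b m hm a ha i y hy
    induction b using induction_on_algGrading with
    | add b c hb hc =>
      rw [op_add, add_smul, map_add]
      exact add_mem hb hc
    | hom n b hb =>
      have hab := mul_mem_algGrading ha hb
      rw [← mul_smul, ← op_mul, gradedPart_of_mem h.isInternal (h.smul_mem i _ y hy _ hab)]
      split_ifs with e
      · refine AddSubgroup.subset_closure ⟨m + n, by omega, y, ?_, _, hab, rfl⟩
        rwa [← e, add_sub_cancel_right]
      · exact zero_mem _
  -- All multiples of `x` are treated at once so that the induction over the span passes through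
  -- scalar multiplication.
  have key' : ∀ b : (PathAlgebra k V ⧸ I)ᵐᵒᵖ,
      gradedPart h.isInternal j (b • x) ∈ productSpan I gr 1 j := by
    induction hx using Submodule.span_induction with
    | mem x hx =>
      obtain ⟨y, m, hm, a, ha, rfl⟩ := hx
      intro b
      have : y ∈ ((productSpan I gr 1 j).comap (gradedPart h.isInternal j)).comap
          ((DistribSMul.toAddMonoidHom M b).comp (DistribSMul.toAddMonoidHom M (op a))) :=
        mem_of_forall_gradedPart_mem h.isInternal fun i =>
          key (unop b) m hm a ha i _ (gradedPart_mem h.isInternal i y)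
      exact this
    | zero =>
      intro b
      rw [smul_zero, map_zero]
      exact zero_mem _
    | add x y _ _ hx hy =>
      intro b
      rw [smul_add, map_add]
      exact add_mem (hx b) (hy b)
    | smul c x _ ih =>
      intro b
      rw [← mul_smul]
      exact ih (b * c)
  simpa using key' 1

theorem productSpan_le_radSubmodule (j : ℤ) {x : M} (hx : x ∈ productSpan I gr 1 j) :
    x ∈ radSubmodule I M := by
  have : productSpan I gr 1 j ≤ (radSubmodule I M).toAddSubgroup := by
    refine (AddSubgroup.closure_le _).2 ?_
    rintro _ ⟨m, hm, x, -, a, ha, rfl⟩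
    exact Submodule.subset_span ⟨x, m, hm, a, ha, rfl⟩
  exact this hx

theorem gradedPart_mem_radSubmodule (h : IsGradedModule I gr) {x : M} (hx : x ∈ radSubmodule I M)
    (j : ℤ) : gradedPart h.isInternal j x ∈ radSubmodule I M :=
  productSpan_le_radSubmodule j (gradedPart_mem_productSpan h hx j)

theorem mem_productSpan_of_mem_radSubmodule (h : IsGradedModule I gr) {x : M} {j : ℤ}
    (hx : x ∈ radSubmodule I M) (hj : x ∈ gr j) : x ∈ productSpan I gr 1 j := by
  have := gradedPart_mem_productSpan h hx j
  rwa [gradedPart_self h.isInternal hj] at this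

theorem map_mem_radSubmodule {N : Type*} [AddCommGroup N] [Module (PathAlgebra k V ⧸ I)ᵐᵒᵖ N]
    (f : M →ₗ[(PathAlgebra k V ⧸ I)ᵐᵒᵖ] N) {x : M} (hx : x ∈ radSubmodule I M) :
    f x ∈ radSubmodule I N := by
  have : radSubmodule I M ≤ (radSubmodule I N).comap f := by
    refine Submodule.span_le.2 ?_
    rintro _ ⟨x, m, hm, a, ha, rfl⟩
    exact Submodule.subset_span ⟨f x, m, hm, a, ha, map_smul _ _ _⟩
  exact this hx

/-- No lower bound on the grading is assumed. Below `a` positive-degree factors can be split off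
indefinitely, so every linear functional sends `x` to a class represented in arbitrarily large
lengths, that is, to zero. The coordinates of an embedding of the projective module into a free one
are such functionals. -/
theorem eq_zero_of_forall_lt_mem_radSubmodule (hI : IsHomogeneousRelationIdeal I)
    (h : IsGradedModule I gr) [Module.Projective (PathAlgebra k V ⧸ I)ᵐᵒᵖ M] {a : ℤ}
    (ha : ∀ j < a, ∀ x ∈ gr j, x ∈ radSubmodule I M) {j : ℤ} (hj : j < a) {x : M}
    (hx : x ∈ gr j) : x = 0 := by
  have key : ∀ N : ℕ, ∀ j < a, gr j ≤ productSpan I gr N j := by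
    intro N
    induction N with
    | zero =>
      intro j _ x hx
      exact AddSubgroup.subset_closure ⟨0, le_rfl, x, by simpa using hx, 1, one_mem_algGrading,
        by rw [op_one, one_smul]⟩
    | succ N ih =>
      intro j hj
      refine (ih j hj).trans ((AddSubgroup.closure_le _).2 ?_)
      rintro _ ⟨m, hm, y, hy, b, hb, rfl⟩
      -- The factor `y` has degree at most `j`, hence again lies in the radical and releases one
      -- more factor of positive degree.
      have hlt : j - m < a := by omega
      have hy' := mem_productSpan_of_mem_radSubmodule h (ha _ hlt y hy) hy
      have hle : productSpan I gr 1 (j - m) ≤ (productSpan I gr (N + 1) j).comap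
          (DistribSMul.toAddMonoidHom M (op b)) := by
        refine (AddSubgroup.closure_le _).2 ?_
        rintro _ ⟨m', hm', z, hz, c, hc, rfl⟩
        refine AddSubgroup.subset_closure ⟨m' + m, by omega, z, ?_, c * b,
          mul_mem_algGrading hc hb, ?_⟩
        · convert hz using 2
          push_cast
          ring
        · rw [op_mul, mul_smul]
          rfl
      exact hle hy'
  have hφ : ∀ φ : M →ₗ[(PathAlgebra k V ⧸ I)ᵐᵒᵖ] (PathAlgebra k V ⧸ I)ᵐᵒᵖ, φ x = 0 := by
    intro φ
    rw [← unop_eq_zero_iff]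
    refine eq_zero_of_forall_le_len hI fun N => ?_
    let L : AddSubgroup M :=
      { carrier := {y | ∃ z, (∀ p, coeff z p ≠ 0 → N ≤ p.len) ∧
          Ideal.Quotient.mk I z = unop (φ y)}
        zero_mem' := ⟨0, fun p hp => absurd rfl hp, by simp⟩
        add_mem' := by
          rintro y y' ⟨z, hz, e⟩ ⟨z', hz', e'⟩
          refine ⟨z + z', fun p hp => ?_, by rw [map_add, e, e', map_add, unop_add]⟩
          by_contra hlt
          rw [coeff_add, not_not.1 (mt (hz p) hlt), not_not.1 (mt (hz' p) hlt), add_zero] at hp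
          exact hp rfl
        neg_mem' := by
          rintro y ⟨z, hz, e⟩
          refine ⟨0 - z, fun p hp => hz p ?_, by rw [zero_sub, map_neg, e, map_neg, unop_neg]⟩
          rw [coeff_sub, coeff_zero, zero_sub] at hp
          exact neg_ne_zero.1 hp }
    have hL : productSpan I gr N j ≤ L := by
      refine (AddSubgroup.closure_le _).2 ?_
      rintro _ ⟨m, hm, y, -, b, ⟨z, hz, rfl⟩, rfl⟩
      obtain ⟨z', hz'⟩ := Ideal.Quotient.mk_surjective (unop (φ y))
      refine ⟨z' * z, fun p hp => ?_, ?_⟩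
      · obtain ⟨q, r, hm', -, hr⟩ := exists_of_coeff_mul_ne_zero hp
        obtain ⟨h1, rfl⟩ := QPath.mul?_eq_some_iff.1 hm'
        rw [QPath.len_cat h1, hz r hr]
        omega
      · rw [map_mul, hz', map_smul]
        rfl
    exact hL (key N j hj hx)
  obtain ⟨s, hs⟩ := Module.Projective.out (R := (PathAlgebra k V ⧸ I)ᵐᵒᵖ) (P := M)
  rw [← hs x]
  have : s x = 0 := Finsupp.ext fun i => hφ ((Finsupp.lapply i).comp s)
  simp [this]

/-- A graded projective module is generated in the degrees in which it is not contained in its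
radical, provided that these are bounded below. -/
theorem span_eq_top_of_forall_notMem (hI : IsHomogeneousRelationIdeal I)
    (h : IsGradedModule I gr) [Module.Projective (PathAlgebra k V ⧸ I)ᵐᵒᵖ M] (D : Set ℤ) (a : ℤ)
    (ha : ∀ j ∈ D, a ≤ j) (hD : ∀ j ∉ D, ∀ x ∈ gr j, x ∈ radSubmodule I M) :
    Submodule.span (PathAlgebra k V ⧸ I)ᵐᵒᵖ {x : M | ∃ j ∈ D, x ∈ gr j} = ⊤ := by
  set N := Submodule.span (PathAlgebra k V ⧸ I)ᵐᵒᵖ {x : M | ∃ j ∈ D, x ∈ gr j} with hN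
  have key : ∀ n : ℕ, ∀ j < a + n, gr j ≤ N.toAddSubgroup := by
    intro n
    induction n with
    | zero =>
      intro j hj x hx
      have : x = 0 := eq_zero_of_forall_lt_mem_radSubmodule hI h
        (fun j hj => hD j fun hj' => (ha j hj').not_gt hj) (by simpa using hj) hx
      rw [this]
      exact zero_mem _
    | succ n ih =>
      intro j hj x hx
      by_cases hjD : j ∈ D
      · exact Submodule.subset_span ⟨j, hjD, hx⟩
      -- In a degree outside `D` the elements are sums of products `y b` with `y` of strictly
      -- smaller degree, where the induction hypothesis applies.
      · have hle : productSpan I gr 1 j ≤ N.toAddSubgroup := by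
          refine (AddSubgroup.closure_le _).2 ?_
          rintro _ ⟨m, hm, y, hy, b, -, rfl⟩
          push_cast at hj
          exact N.smul_mem _ (ih (j - m) (by omega) hy)
        exact hle (mem_productSpan_of_mem_radSubmodule h (hD j hjD x hx) hx)
  refine eq_top_iff.2 fun x _ => mem_of_forall_gradedPart_mem h.isInternal (N := N.toAddSubgroup)
    fun i => key (i - a + 1).toNat i ?_ (gradedPart_mem _ i x)
  omega

end Nakayama

/-! ### Vectors over the quotient algebra -/

section QuotVec

variable {k : Type w} {V : Type u} [Field k] [Quiver.{v} V] [Fintype V] {T₀ : Type*}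
  (I : Ideal (PathAlgebra k V)) [I.IsTwoSided]

/-- Reduction modulo `I` of the entries of a vector. -/
def quotVec : (TipIndex T₀ V →₀ PathAlgebra k V) →+ (TipIndex T₀ V →₀ PathAlgebra k V ⧸ I) :=
  Finsupp.mapRange.addMonoidHom (Ideal.Quotient.mk I).toAddMonoidHom

variable {I}

@[simp]
theorem quotVec_apply (x : TipIndex T₀ V →₀ PathAlgebra k V) (t : TipIndex T₀ V) :
    quotVec I x t = Ideal.Quotient.mk I (x t) := rfl

theorem quotVec_single (t : TipIndex T₀ V) (a : PathAlgebra k V) :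
    quotVec I (Finsupp.single t a) = Finsupp.single t (Ideal.Quotient.mk I a) :=
  Finsupp.mapRange_single (hf := map_zero _)

theorem quotVec_eq_zero_iff {x : TipIndex T₀ V →₀ PathAlgebra k V} :
    quotVec I x = 0 ↔ ∀ t, x t ∈ I := by
  simp [Finsupp.ext_iff, Ideal.Quotient.eq_zero_iff_mem]

theorem quotVec_smul (a : PathAlgebra k V) (x : TipIndex T₀ V →₀ PathAlgebra k V) :
    quotVec I (op a • x) = op (Ideal.Quotient.mk I a) • quotVec I x := by
  ext t
  simp [MulOpposite.smul_eq_mul_unop]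

theorem quotVec_evalMap (h : TipIndex T₀ V → TipIndex T₀ V →₀ PathAlgebra k V)
    (y : TipIndex T₀ V →₀ PathAlgebra k V) :
    quotVec I (evalMap h y) = evalMap (fun t => quotVec I (h t)) (quotVec I y) := by
  induction y using Finsupp.induction_linear with
  | zero => simp
  | add x y hx hy => simp only [map_add, hx, hy]
  | single t a => rw [evalMap_single, quotVec_single, evalMap_single, quotVec_smul]

theorem evalMap_hom_ext {R M ι : Type*} [Ring R] [AddCommGroup M] [Module Rᵐᵒᵖ M]
    {f g : (ι →₀ R) →ₗ[Rᵐᵒᵖ] M}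
    (h : ∀ i, f (Finsupp.single i 1) = g (Finsupp.single i 1)) : f = g := by
  refine Finsupp.lhom_ext fun i a => ?_
  have e : (Finsupp.single i a : ι →₀ R) = op a • Finsupp.single i 1 := by
    rw [Finsupp.smul_single, MulOpposite.smul_eq_mul_unop, one_mul, unop_op]
  rw [e, map_smul, map_smul, h]

variable (I) in
/-- The direct sum of the right modules `t A`, `t ∈ T`. -/
def genSubmodule (T : Set (TipIndex T₀ V)) :
    Submodule (PathAlgebra k V ⧸ I)ᵐᵒᵖ (TipIndex T₀ V →₀ PathAlgebra k V ⧸ I) where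
  carrier := {x | ∀ t, (t ∉ T → x t = 0) ∧
    Ideal.Quotient.mk I (ofPath k (QPath.vertex t.word.tgt)) * x t = x t}
  add_mem' {x y} hx hy t := ⟨fun ht => by
    rw [Finsupp.add_apply, (hx t).1 ht, (hy t).1 ht, add_zero], by
    rw [Finsupp.add_apply, mul_add, (hx t).2, (hy t).2]⟩
  zero_mem' t := by simp
  smul_mem' c x hx t := ⟨fun ht => by
    rw [Finsupp.smul_apply, (hx t).1 ht, smul_zero], by
    rw [Finsupp.smul_apply, MulOpposite.smul_eq_mul_unop, ← mul_assoc, (hx t).2]⟩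

theorem IsSupportedOn.quotVec_mem {T : Set (TipIndex T₀ V)}
    {x : TipIndex T₀ V →₀ PathAlgebra k V} (hx : IsSupportedOn T x) :
    quotVec I x ∈ genSubmodule I T := by
  intro t
  constructor
  · intro ht
    have : x t = 0 := coeff_ext fun p => by
      by_contra hne
      exact ht (hx t p hne).1
    rw [quotVec_apply, this, map_zero]
  · rw [quotVec_apply, ← map_mul, vertex_mul_eq_iff.2 fun p hp => (hx t p hp).2.symm]

theorem exists_quotVec_eq {T : Set (TipIndex T₀ V)}
    {x : TipIndex T₀ V →₀ PathAlgebra k V ⧸ I} (hx : x ∈ genSubmodule I T) :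
    ∃ y, IsSupportedOn T y ∧ quotVec I y = x := by
  choose f hf using Ideal.Quotient.mk_surjective (I := I)
  refine ⟨Finsupp.onFinset x.support
    (fun t => if x t = 0 then 0 else ofPath k (QPath.vertex t.word.tgt) * f (x t)) ?_, ?_, ?_⟩
  · intro t ht
    rw [Finsupp.mem_support_iff]
    intro h0
    simp [h0] at ht
  · intro t u ho
    rw [Occurs, Finsupp.onFinset_apply] at ho
    split_ifs at ho with h0
    · exact absurd rfl ho
    · refine ⟨by_contra fun ht => h0 ((hx t).1 ht), Eq.symm ?_⟩
      refine vertex_mul_eq_iff.1 ?_ u ho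
      rw [← mul_assoc]
      congr 1
      exact vertex_mul_eq_iff.2 fun p hp => by rw [← eq_of_coeff_ofPath_ne_zero hp, QPath.vertex_src]
  · ext t
    rw [quotVec_apply, Finsupp.onFinset_apply]
    split_ifs with h0
    · rw [h0, map_zero]
    · rw [map_mul, hf, (hx t).2]

theorem evalMap_quotVec_mem {M : Type*} [AddCommGroup M] [Module (PathAlgebra k V ⧸ I)ᵐᵒᵖ M]
    {gr : ℤ → AddSubgroup M} (hgr : IsGradedModule I gr) {deg : T₀ → ℤ} {m : TipIndex T₀ V → M}
    (hm : ∀ t, m t ∈ gr (deg t.place + t.word.len)) {c : ℤ}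
    {x : TipIndex T₀ V →₀ PathAlgebra k V} (hx : ∀ t u, Occurs x t u → (t.cls deg u).1 = c) :
    evalMap m (quotVec I x) ∈ gr c := by
  rw [evalMap_apply]
  refine sum_mem fun t _ => ?_
  by_cases h0 : x t = 0
  · rw [quotVec_apply, h0, map_zero, op_zero, zero_smul]
    exact zero_mem _
  · obtain ⟨u, hu⟩ : ∃ u, coeff (x t) u ≠ 0 := by
      by_contra! hne
      exact h0 (coeff_ext hne)
    have hc := hx t u hu
    rw [← hc]
    refine hgr.smul_mem _ u.len _ (hm t) _ ⟨x t, fun p hp => ?_, rfl⟩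
    have := (hx t p hp).trans hc.symm
    simp only [TipIndex.cls] at this
    omega

end QuotVec

/-! ### Comparison of resolutions -/

section Comparison

/-- Lifting through the restriction of `f` to `E`, while keeping the larger module `M` as the
target. Maps out of a free `M` can then still be prescribed on its basis, without considering the
submodules `E` as sources. -/
theorem exists_lift_mem {S P M N : Type*} [Ring S] [AddCommGroup P] [Module S P]
    [Module.Projective S P] [AddCommGroup M] [Module S M] [AddCommGroup N] [Module S N]
    (f : M →ₗ[S] N) (E : Submodule S M) (g : P →ₗ[S] N) (hg : ∀ x, ∃ y ∈ E, f y = g x) :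
    ∃ φ : P →ₗ[S] M, (∀ x, φ x ∈ E) ∧ ∀ x, f (φ x) = g x := by
  have hg' : ∀ x, g x ∈ LinearMap.range (f.domRestrict E) := fun x => by
    obtain ⟨y, hy, e⟩ := hg x
    exact ⟨⟨y, hy⟩, e⟩
  obtain ⟨φ, hφ⟩ := Module.projective_lifting_property (f.domRestrict E).rangeRestrict
    (g.codRestrict _ hg') (f.domRestrict E).surjective_rangeRestrict
  exact ⟨E.subtype.comp φ, fun x => (φ x).2, fun x =>
    congrArg Subtype.val (LinearMap.congr_fun hφ x)⟩

variable {S : Type*} [Ring S] {P : ℕ → Type*} [∀ n, AddCommGroup (P n)] [∀ n, Module S (P n)]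
  [∀ n, Module.Projective S (P n)] {F : Type*} [AddCommGroup F] [Module S F]

/-- The composite of comparison maps between a projective resolution and a resolution by the
submodules `E n` is homotopic to the identity. The predicate `Q` is any further property of maps
out of `F` that can be ensured in the construction. -/
theorem exists_comparison (d : ∀ n, P (n + 1) →ₗ[S] P n)
    (hd : ∀ n, Function.Exact (d (n + 1)) (d n)) (E : ℕ → Submodule S F)
    (ε : F →ₗ[S] P 0) (δ : ℕ → F →ₗ[S] F)
    (hε : ∀ x, ∃ y ∈ E 0, ε y = d 0 x)
    (hδε : ∀ y, ε (δ 0 y) = 0) (hεδ : ∀ x ∈ E 0, ε x = 0 → ∃ y ∈ E 1, δ 0 y = x)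
    (hδδ : ∀ n y, δ n (δ (n + 1) y) = 0)
    (hex : ∀ n, ∀ x ∈ E (n + 1), δ n x = 0 → ∃ y ∈ E (n + 2), δ (n + 1) y = x)
    (Q : ∀ n, (F →ₗ[S] P (n + 1)) → Prop)
    (hQ₀ : ∃ ψ, Q 0 ψ ∧ ∀ x, d 0 (ψ x) = ε x)
    (hQ : ∀ n ψ, Q n ψ → (∀ y, d n (ψ (δ n y)) = 0) →
      ∃ ψ', Q (n + 1) ψ' ∧ ∀ x, d (n + 1) (ψ' x) = ψ (δ n x)) (n : ℕ) :
    ∃ (ψ : F →ₗ[S] P (n + 1)) (φ : P (n + 1) →ₗ[S] F) (σ : P (n + 1) →ₗ[S] P (n + 2))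
      (ρ : P n →ₗ[S] P (n + 1)), Q n ψ ∧ ∀ x, ψ (φ x) - x = d (n + 1) (σ x) + ρ (d n x) := by
  -- The two added clauses are what the next stage needs: boundaries go to cycles under `ψ`, and
  -- cycles go to boundaries under `φ`.
  suffices h : ∃ (ψ : F →ₗ[S] P (n + 1)) (φ : P (n + 1) →ₗ[S] F) (σ : P (n + 1) →ₗ[S] P (n + 2))
      (ρ : P n →ₗ[S] P (n + 1)), (Q n ψ ∧ ∀ x, ψ (φ x) - x = d (n + 1) (σ x) + ρ (d n x)) ∧
      (∀ y, d n (ψ (δ n y)) = 0) ∧ ∀ x, d n x = 0 → ∃ y ∈ E (n + 1), δ n y = φ x by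
    obtain ⟨ψ, φ, σ, ρ, h, -⟩ := h
    exact ⟨ψ, φ, σ, ρ, h⟩
  induction n with
  | zero =>
    obtain ⟨ψ, hψ, hψd⟩ := hQ₀
    obtain ⟨φ, hφ, hφd⟩ := exists_lift_mem ε (E 0) (d 0) hε
    obtain ⟨σ, -, hσ⟩ := exists_lift_mem (d 1) ⊤ (ψ.comp φ - LinearMap.id) fun x => by
      obtain ⟨y, hy⟩ := (hd 0 (ψ (φ x) - x)).1 (by rw [map_sub, hψd, hφd, sub_self])
      exact ⟨y, trivial, hy⟩
    -- Both complexes are compared over the image of `d 0`, where the comparison is the identity;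
    -- hence the lowest homotopy term is zero.
    refine ⟨ψ, φ, σ, 0, ⟨hψ, fun x => ?_⟩, fun y => ?_, fun x hx => ?_⟩
    · rw [LinearMap.zero_apply, add_zero]
      exact (hσ x).symm
    · rw [hψd, hδε]
    · exact hεδ _ (hφ x) (by rw [hφd, hx])
  | succ n ih =>
    obtain ⟨ψ, φ, σ, ρ, ⟨hψ, hh⟩, hψ0, hφ0⟩ := ih
    obtain ⟨ψ', hψ', hψd⟩ := hQ n ψ hψ hψ0
    obtain ⟨φ', hφ', hφd⟩ := exists_lift_mem (δ n) (E (n + 1)) (φ.comp (d (n + 1))) fun x =>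
      hφ0 _ ((hd n _).2 ⟨x, rfl⟩)
    obtain ⟨σ', -, hσ⟩ := exists_lift_mem (d (n + 2)) ⊤
      (ψ'.comp φ' - LinearMap.id - σ.comp (d (n + 1))) fun x => by
        obtain ⟨y, hy⟩ := (hd (n + 1) (ψ' (φ' x) - x - σ (d (n + 1) x))).1 (by
          have h0 : d n (d (n + 1) x) = 0 := (hd n _).2 ⟨x, rfl⟩
          rw [map_sub, map_sub, hψd, hφd, LinearMap.comp_apply, hh, h0, map_zero, add_zero,
            sub_self])
        exact ⟨y, trivial, hy⟩
    -- The upper homotopy term of one stage is the lower one of the next.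
    refine ⟨ψ', φ', σ', σ, ⟨hψ', fun x => ?_⟩, fun y => ?_, fun x hx => ?_⟩
    · rw [hσ]
      simp
    · rw [hψd, hδδ, map_zero]
    · exact hex n _ (hφ' x) (by rw [hφd, LinearMap.comp_apply, hx, map_zero])

end Comparison

/-! ### Generator degrees of a minimal resolution -/

section Minimal

variable {k : Type w} {V : Type u} [Field k] [Quiver.{v} V] [Fintype V]
  {I : Ideal (PathAlgebra k V)} [I.IsTwoSided]
  {X : Type*} [AddCommGroup X] [Module (PathAlgebra k V ⧸ I)ᵐᵒᵖ X] {grX : ℤ → AddSubgroup X}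

theorem MinimalGradedResolution.exists_homogeneous_lift (R : MinimalGradedResolution I grX)
    (n : ℕ) {c : ℤ} {x : R.P n} (hx : x ∈ R.gr n c) (h : ∃ y, R.d n y = x) :
    ∃ y ∈ R.gr (n + 1) c, R.d n y = x := by
  obtain ⟨y, rfl⟩ := h
  refine ⟨gradedPart (R.graded (n + 1)).isInternal c y, gradedPart_mem _ _ _, ?_⟩
  -- A degree-preserving map commutes with taking components, so the component of degree `c` of any
  -- lift is again a lift.
  have key : ∀ z : R.P (n + 1), z ∈ AddMonoidHom.eqLocus
      ((R.d n).toAddMonoidHom.comp (gradedPart (R.graded (n + 1)).isInternal c))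
      ((gradedPart (R.graded n).isInternal c).comp (R.d n).toAddMonoidHom) := by
    intro z
    refine mem_of_forall_gradedPart_mem (R.graded (n + 1)).isInternal fun i => ?_
    have hz := gradedPart_mem (R.graded (n + 1)).isInternal i z
    change R.d n (gradedPart _ c _) = gradedPart _ c (R.d n _)
    rw [gradedPart_of_mem _ hz, gradedPart_of_mem _ (R.d_mem n i _ hz)]
    split_ifs
    · rfl
    · exact map_zero _
  exact (key y).trans (gradedPart_self (R.graded n).isInternal hx)

variable {T₀ : Type*} [LinearOrder T₀] [LinearOrder (QPath V)] [Finite T₀]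
  [WellFoundedLT (QPath V)] {G : Set (PathAlgebra k V)} {deg : T₀ → ℤ}

/-- Outside of the degrees of the generators of some resolution, the modules of a minimal graded
resolution are contained in their radicals. -/
theorem MinimalGradedResolution.mem_radSubmodule (R : MinimalGradedResolution I grX)
    {T : ℕ → Set (TipIndex T₀ V)}
    {f : ℕ → TipIndex T₀ V → TipIndex T₀ V →₀ PathAlgebra k V}
    (hord : QPath.IsAdmissibleOrder V) (hI : IsHomogeneousRelationIdeal I)
    (hG : IsGroebnerBasis I G)
    (hf : ∀ n, IsResolutionStep deg I (tipSet G) (T n) (stepKernel I (T n) (f n)) (T (n + 1))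
      (f (n + 1)))
    (hT0 : ∀ t ∉ T 0, f 0 t = 0)
    (g : (TipIndex T₀ V →₀ PathAlgebra k V ⧸ I) →ₗ[(PathAlgebra k V ⧸ I)ᵐᵒᵖ] R.P 0)
    (hg : ∀ y : TipIndex T₀ V →₀ PathAlgebra k V, IsSupportedOn (T 0) y → g (quotVec I (evalMap (f 0) y)) = 0 →
      ∀ t, evalMap (f 0) y t ∈ I)
    (hg' : ∀ x, ∃ y : TipIndex T₀ V →₀ PathAlgebra k V, IsSupportedOn (T 0) y ∧ g (quotVec I (evalMap (f 0) y)) = R.d 0 x)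
    (hgd : ∀ t ∈ T 0, g (quotVec I (f 0 t)) ∈ R.gr 0 (deg t.place + t.word.len) ∧
      R.aug (g (quotVec I (f 0 t))) = 0)
    (n : ℕ) {j : ℤ} (hj : ∀ t ∈ T n, deg t.place + t.word.len ≠ j) {x : R.P (n + 1)}
    (hx : x ∈ R.gr (n + 1) j) : x ∈ radSubmodule I (R.P (n + 1)) := by
  have := R.projective
  let δ : ℕ → (TipIndex T₀ V →₀ PathAlgebra k V ⧸ I) →ₗ[(PathAlgebra k V ⧸ I)ᵐᵒᵖ]
      (TipIndex T₀ V →₀ PathAlgebra k V ⧸ I) := fun n => evalMap fun t => quotVec I (f n t)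
  have hker : ∀ n t r, evalMap (f n) (f (n + 1) t) r ∈ I := by
    intro n t
    by_cases ht : t ∈ T (n + 1)
    · exact ((hf n).mem_ker t ht).2
    · simp [(hf n).eq_zero t ht]
  have hδδ : ∀ n y, δ n (δ (n + 1) y) = 0 := by
    intro n y
    have : (δ n).comp (δ (n + 1)) = 0 := by
      refine evalMap_hom_ext fun t => ?_
      rw [LinearMap.comp_apply, evalMap_single, op_one, one_smul, ← quotVec_evalMap,
        quotVec_eq_zero_iff.2 (hker n t), LinearMap.zero_apply]
    exact LinearMap.congr_fun this y
  -- Exactness over `A`: dividing a cycle modulo `I` by the next family leaves a remainder with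
  -- entries in `I`, which vanishes in the quotient.
  have hdiv : ∀ n y, IsSupportedOn (T n) y → (∀ r, evalMap (f n) y r ∈ I) →
      ∃ z ∈ genSubmodule I (T (n + 1)), δ (n + 1) z = quotVec I y := by
    intro n y hy hyI
    by_cases h0 : y = 0
    · exact ⟨0, zero_mem _, by simp [h0]⟩
    obtain ⟨t, u, hl⟩ := exists_isLead h0
    obtain ⟨z, hz, -, hzI⟩ := (hf n).exists_division hord hI hG Set.univ (t.key u) y ⟨hy, hyI⟩
      fun r p ho => ⟨hl.2 r p ho, trivial⟩
    refine ⟨quotVec I z, hz.quotVec_mem, ?_⟩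
    rw [← quotVec_evalMap, ← sub_eq_zero, ← neg_eq_zero, neg_sub, ← map_sub]
    exact quotVec_eq_zero_iff.2 hzI
  obtain ⟨ψ, φ, σ, ρ, ⟨m, rfl, hm, hm0⟩, hh⟩ := exists_comparison R.d R.exact_succ
    (fun n => genSubmodule I (T n)) (g.comp (δ 0)) (fun n => δ (n + 1))
    (by
      intro x
      obtain ⟨y, hy, e⟩ := hg' x
      refine ⟨quotVec I y, hy.quotVec_mem, ?_⟩
      rw [LinearMap.comp_apply, ← quotVec_evalMap, e])
    (fun y => by rw [LinearMap.comp_apply, hδδ, map_zero])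
    (by
      intro x hx h0
      obtain ⟨y, hy, rfl⟩ := exists_quotVec_eq hx
      rw [LinearMap.comp_apply, ← quotVec_evalMap] at h0
      exact hdiv 0 y hy (hg y hy h0))
    (fun n => hδδ (n + 1))
    (by
      intro n x hx h0
      obtain ⟨y, hy, rfl⟩ := exists_quotVec_eq hx
      rw [← quotVec_evalMap, quotVec_eq_zero_iff] at h0
      exact hdiv (n + 1) y hy h0)
    -- The map back to the minimal resolution is required to be homogeneous on generators and to
    -- vanish off `T n`, so only degrees of actual generators enter its values.
    (fun n ψ => ∃ m : TipIndex T₀ V → R.P (n + 1), ψ = evalMap m ∧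
      (∀ t, m t ∈ R.gr (n + 1) (deg t.place + t.word.len)) ∧ ∀ t ∉ T n, m t = 0)
    (by
      have key : ∀ t, ∃ y ∈ R.gr 1 (deg t.place + t.word.len), R.d 0 y = g (quotVec I (f 0 t)) ∧
          (t ∉ T 0 → y = 0) := by
        intro t
        by_cases ht : t ∈ T 0
        · obtain ⟨y, hy, e⟩ := R.exists_homogeneous_lift 0 (hgd t ht).1
            ((R.exact_zero _).1 (hgd t ht).2)
          exact ⟨y, hy, e, fun h => absurd ht h⟩
        · exact ⟨0, zero_mem _, by simp [hT0 t ht], fun _ => rfl⟩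
      choose m hm hmd hm0 using key
      refine ⟨evalMap m, ⟨m, rfl, hm, hm0⟩, fun x => ?_⟩
      have : (R.d 0).comp (evalMap m) = g.comp (δ 0) := by
        refine evalMap_hom_ext fun t => ?_
        rw [LinearMap.comp_apply, LinearMap.comp_apply, evalMap_single, evalMap_single, op_one,
          one_smul, one_smul, hmd]
      exact LinearMap.congr_fun this x)
    (by
      rintro n _ ⟨m, rfl, hm, -⟩ h0
      have key : ∀ t, ∃ y ∈ R.gr (n + 2) (deg t.place + t.word.len),
          R.d (n + 1) y = evalMap m (quotVec I (f (n + 1) t)) ∧ (t ∉ T (n + 1) → y = 0) := by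
        intro t
        by_cases ht : t ∈ T (n + 1)
        · have h1 := h0 (Finsupp.single t 1)
          rw [evalMap_single, op_one, one_smul] at h1
          obtain ⟨y, hy, e⟩ := R.exists_homogeneous_lift (n + 1)
            (evalMap_quotVec_mem (R.graded (n + 1)) hm fun r p ho =>
              congrArg Prod.fst ((hf n).cls t ht r p ho)) ((R.exact_succ n _).1 h1)
          exact ⟨y, hy, e, fun h => absurd ht h⟩
        · exact ⟨0, zero_mem _, by simp [(hf n).eq_zero t ht], fun _ => rfl⟩
      choose m' hm' hmd hm0 using key
      refine ⟨evalMap m', ⟨m', rfl, hm', hm0⟩, fun x => ?_⟩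
      have : (R.d (n + 1)).comp (evalMap m') = (evalMap m).comp (δ (n + 1)) := by
        refine evalMap_hom_ext fun t => ?_
        rw [LinearMap.comp_apply, LinearMap.comp_apply, evalMap_single, evalMap_single, op_one,
          one_smul, one_smul, hmd]
      exact LinearMap.congr_fun this x) n
  have hint := (R.graded (n + 1)).isInternal
  -- Both homotopy terms lie in the radical by minimality; only the component of degree `j` of
  -- `evalMap m (φ x)` remains.
  have e : x = evalMap m (φ x) - (R.d (n + 1) (σ x) + ρ (R.d n x)) := by
    rw [← hh]
    abel
  rw [← gradedPart_self hint hx, e, map_sub]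
  refine sub_mem ?_ ?_
  · rw [evalMap_apply, map_sum]
    refine sum_mem fun t _ => ?_
    by_cases ht : t ∈ T n
    -- A coefficient of degree zero leaves `m t` in the degree of `t`, which is not `j`; a
    -- coefficient of positive degree produces an element of the radical.
    · induction φ x t using induction_on_algGrading with
      | add a b ha hb =>
        rw [op_add, add_smul, map_add]
        exact add_mem ha hb
      | hom i a ha =>
        rcases Nat.eq_zero_or_pos i with rfl | hi
        · rw [gradedPart_of_mem hint ((R.graded (n + 1)).smul_mem _ 0 _ (hm t) a ha), if_neg]
          · exact zero_mem _
          · simpa using hj t ht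
        · exact gradedPart_mem_radSubmodule (R.graded (n + 1))
            (Submodule.subset_span ⟨_, i, hi, a, ha, rfl⟩) j
    · rw [hm0 t ht, smul_zero, map_zero]
      exact zero_mem _
  · refine gradedPart_mem_radSubmodule (R.graded (n + 1)) (add_mem ?_ ?_) j
    · exact R.minimal (n + 1) ⟨_, rfl⟩
    · exact map_mem_radSubmodule ρ (R.minimal n ⟨_, rfl⟩)

end Minimal

/-! ### Quasioverlaps and the degrees of the generators -/

section QuasiOverlaps

variable {V : Type u} [Quiver.{v} V] {T₀ : Type*} {S : Set (QPath V)} {T : Set (TipIndex T₀ V)}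

/-- Let `s` be a divisor of `p u` in `S`. It cannot end inside `p`, since `p` is reduced, and it
ends at the end of `u` by minimality. It begins inside `p`, strictly before `u`, since `u` is
reduced. Hence `s = v u` with `v` a nontrivial right factor of `p`. -/
theorem QPath.exists_quasiOverlap_one {p u : QPath V} (hpu : p.tgt = u.src)
    (hp : QPath.IsReduced S p) (hu : QPath.IsReduced S u)
    (hred : ¬ QPath.IsReduced S (QPath.cat p u))
    (hmin : ∀ u₁ u₂ : QPath V, u₁.tgt = u₂.src → QPath.cat u₁ u₂ = u → 0 < u₂.len →
      QPath.IsReduced S (QPath.cat p u₁)) :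
    ∃ v, (u, v) ∈ QPath.quasiOverlaps S 1 ∧
      (QPath.vertex u.src, v) ∈ QPath.quasiOverlaps S 0 := by
  have hu0 : 0 < u.len := by
    rcases Nat.eq_zero_or_pos u.len with h0 | h0
    · rw [QPath.cat_of_len_eq_zero hpu h0] at hred
      exact absurd hp hred
    · exact h0
  simp only [QPath.IsReduced, not_forall, not_not] at hred
  obtain ⟨s, hs, hd⟩ := hred
  obtain ⟨a, b, ha, hb, e⟩ := QPath.dvd_iff.1 hd
  have hab : (QPath.cat a s).tgt = b.src := by rw [QPath.cat_tgt ha, hb]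
  rcases QPath.cat_eq_cat hab hpu e with ⟨x, hx, -, e1, -⟩ | ⟨x, hx, hxb, e1, e2⟩
  · refine absurd (QPath.dvd_iff.2 ⟨a, x, ha, ?_, e1.symm⟩) (hp s hs)
    rw [← hx, QPath.cat_tgt ha]
  have hb0 : b.len = 0 := by
    by_contra hne
    refine hmin x b hxb e2.symm (Nat.pos_of_ne_zero hne) s hs ?_
    rw [← e1]
    exact QPath.dvd_iff.2 ⟨a, QPath.vertex s.tgt, ha, rfl, QPath.cat_vertex (QPath.cat_tgt ha)⟩
  rw [QPath.cat_of_len_eq_zero hxb hb0] at e2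
  subst e2
  have hus : ∀ y : QPath V, y.tgt = s.src → u ≠ QPath.cat y s := by
    rintro y hy rfl
    exact hu s hs (QPath.dvd_iff.2 ⟨y, QPath.vertex s.tgt, hy, rfl,
      QPath.cat_vertex (QPath.cat_tgt hy)⟩)
  rcases QPath.cat_eq_cat ha hpu e1 with ⟨v, -, hv, -, e3⟩ | ⟨y, -, hy, -, e3⟩
  · have hv0 : 0 < v.len := by
      rcases Nat.eq_zero_or_pos v.len with h0 | h0
      · refine absurd ?_ (hus (QPath.vertex s.src) rfl)
        rw [QPath.vertex_cat rfl, e3, QPath.eq_vertex_of_len_eq_zero h0, QPath.vertex_cat]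
        rw [QPath.src_eq_tgt_of_len_eq_zero h0, hv]
      · exact h0
    refine ⟨v, ⟨hu0, hv0, s, hs, ?_⟩, rfl, hv0, ?_⟩
    · rw [e3]
      exact QPath.mul?_cat hv
    · simp [QPath.mul?_vertex, hv]
  · exact absurd e3 (hus y hy)

/-- The word of a generator is the word of an initial generator followed by the first component of
a quasioverlap. -/
theorem exists_quasiOverlap_of_mem_chainSet
    (hT : ∀ t ∈ T, t.tail = t.word ∧ QPath.IsReduced S t.word) (n : ℕ) {t : TipIndex T₀ V}
    (ht : t ∈ chainSet S T (n + 1)) :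
    ∃ r ∈ T, ∃ w₁ w v, r.place = t.place ∧ r.word.tgt = w.src ∧ QPath.cat r.word w = t.word ∧
      w₁.tgt = t.tail.src ∧ QPath.cat w₁ t.tail = w ∧ (w₁, v) ∈ QPath.quasiOverlaps S n ∧
      (w, v) ∈ QPath.quasiOverlaps S (n + 1) := by
  induction n generalizing t with
  | zero =>
    obtain ⟨r, hr, h1, h2, h3, h4, h5⟩ := ht
    -- For initial indices the tail is the whole word, so the overlap condition involves the word
    -- itself.
    obtain ⟨e, hred⟩ := hT r hr
    rw [e] at h4 h5
    obtain ⟨v, hv1, hv0⟩ := QPath.exists_quasiOverlap_one h1 hred h3 h4 h5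
    refine ⟨r, hr, QPath.vertex t.tail.src, t.tail, v, ?_, h1, ?_, rfl, QPath.vertex_cat rfl, hv0,
      hv1⟩
    · rw [← h2]
      rfl
    · conv_rhs => rw [← h2]
      rfl
  | succ n ih =>
    obtain ⟨r, hr, h1, h2, h3, h4, h5⟩ := ht
    obtain ⟨q, hq, w₁, w, v, hpl, hqw, hw, hw₁, rfl, hv1, hv⟩ := ih hr
    have hwt : (QPath.cat w₁ r.tail).tgt = r.word.tgt := by
      rw [← hw, QPath.cat_tgt hqw]
    have hrt : r.tail.tgt = t.tail.src := by
      rw [← h1, ← hwt, QPath.cat_tgt hw₁]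
    have hw₁' : w₁.tgt = (QPath.cat r.tail t.tail).src := by simpa using hw₁
    have hassoc := QPath.cat_assoc hw₁ hrt
    -- The two earlier quasioverlaps are those of `r`. The longer vanishes on the new word because
    -- `t.tail` is reduced; the shorter almost vanishes because `r.tail t.tail` is minimally
    -- non-reduced.
    refine ⟨q, hq, QPath.cat w₁ r.tail, _, v, ?_, by simpa using hqw, ?_, hwt.trans h1, rfl, hv,
      QPath.cat w₁ r.tail, w₁, hv, hv1, (QPath.vanishes_cat_iff (hwt.trans h1)).2 h3,
      QPath.cat r.tail t.tail, ?_, ?_, ?_⟩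
    · rw [hpl, ← h2]
      rfl
    · rw [← QPath.cat_assoc hqw (hwt.trans h1), hw]
      conv_rhs => rw [← h2]
      rfl
    · rw [hassoc]
      exact QPath.mul?_cat hw₁'
    · change ¬ QPath.Vanishes S w₁ (QPath.cat (QPath.cat w₁ r.tail) t.tail)
      rw [hassoc, QPath.vanishes_cat_iff hw₁']
      exact h4
    · intro u₁ u₂ x hu hu₂ hx
      obtain ⟨hu₁₂, e⟩ := QPath.mul?_eq_some_iff.1 hu
      obtain ⟨hw₁u₁, rfl⟩ := QPath.mul?_eq_some_iff.1 hx
      rw [QPath.vanishes_cat_iff hw₁u₁]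
      -- A proper left factor of `r.tail t.tail` either lies inside the reduced path `r.tail` or is
      -- `r.tail` followed by a proper left factor of `t.tail`.
      rcases QPath.cat_eq_cat hu₁₂ hrt e with ⟨y, hy, -, e1, -⟩ | ⟨y, -, hy, rfl, e2⟩
      · have hr3 : QPath.IsReduced S r.tail := by
          obtain ⟨_, _, _, _, h, _⟩ := hr
          exact h
        rw [e1] at hr3
        exact hr3.left hy
      · exact h5 y u₂ hy e2.symm hu₂

/-- At stage zero only the length of the first component matters, so any path of positive length,
paired with the vertex at its end, serves as the quasioverlap; `hV` supplies one. -/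
theorem exists_quasiOverlap_of_chainSet
    (hT : ∀ t ∈ T, t.tail = t.word ∧ QPath.IsReduced S t.word) (hV : ∃ v : QPath V, 0 < v.len)
    (n : ℕ) {t : TipIndex T₀ V} (ht : t ∈ chainSet S T n) :
    ∃ r ∈ T, ∃ x ∈ QPath.quasiOverlaps S n, r.place = t.place ∧
      t.word.len = r.word.len + x.1.len := by
  cases n with
  | zero =>
    obtain ⟨v, hv⟩ := hV
    exact ⟨t, ht, (QPath.vertex v.tgt, v), ⟨rfl, hv, by simp [QPath.mul?_vertex]⟩, rfl, rfl⟩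
  | succ n =>
    obtain ⟨r, hr, -, w, v, h1, h2, h3, -, -, -, h4⟩ := exists_quasiOverlap_of_mem_chainSet hT n ht
    exact ⟨r, hr, (w, v), h4, h1, by rw [← h3, QPath.len_cat h2]⟩

end QuasiOverlaps

/-! ### The initial step -/

section Restrict

variable {k : Type w} {V : Type u} [Field k] [Quiver.{v} V] [Fintype V] {T₀ : Type*}
  [LinearOrder T₀] [LinearOrder (QPath V)]

theorem IsRightTipReduced.eq_of_isVecTip {ι : Type*}
    {H : ι → T₀ → PathAlgebra k V} (hH : IsRightTipReduced H) {i i' : ι} {j : T₀}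
    {p q : QPath V} (h : IsVecTip (H i) j p) (h' : IsVecTip (H i') j q)
    (hd : QPath.DvdLeft p q) : i = i' :=
  by_contra fun hne => hH.2 i i' hne _ _ _ _ h h' ⟨rfl, hd⟩

theorem IsLeadFamily.restrict {deg : T₀ → ℤ} {T T' : Set (TipIndex T₀ V)}
    {h : TipIndex T₀ V → TipIndex T₀ V →₀ PathAlgebra k V} (H : IsLeadFamily deg T T' h)
    (U : Set (TipIndex T₀ V)) :
    IsLeadFamily deg T (T' ∩ U) (fun t => if t ∈ U then h t else 0) where
  prefixFree := H.prefixFree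
  prefixFree' t ht t' ht' := H.prefixFree' t ht.1 t' ht'.1
  eq_zero t ht := by
    split_ifs with hU
    · exact H.eq_zero t fun h' => ht ⟨h', hU⟩
    · rfl
  supp t ht := by
    rw [if_pos ht.2]
    exact H.supp t ht.1
  lead t ht := by
    rw [if_pos ht.2]
    exact H.lead t ht.1
  cls t ht := by
    rw [if_pos ht.2]
    exact H.cls t ht.1

end Restrict

section Initial

variable {k : Type w} {V : Type u} [Field k] [Quiver.{v} V] {T₀ : Type*}

/-- The index of the generator in a given place. -/
def baseIndex (e : T₀ → V) (j : T₀) : TipIndex T₀ V :=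
  ⟨j, QPath.vertex (e j), QPath.vertex (e j)⟩

theorem isPrefixFree_range_baseIndex (e : T₀ → V) : IsPrefixFree (Set.range (baseIndex e)) := by
  rintro _ ⟨j, rfl⟩ _ ⟨j', rfl⟩ h -
  exact congrArg (baseIndex e) h

theorem baseIndex_key {e : T₀ → V} {j : T₀} {u : QPath V} (hu : u.src = e j) :
    (baseIndex e j).key u = toLex (u, j) := by
  rw [TipIndex.key, baseIndex, QPath.vertex_cat hu.symm]

variable [Fintype T₀] [Fintype V]

/-- Coordinate vectors as vectors indexed by `TipIndex`. -/
def baseVec (e : T₀ → V) :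
    (T₀ → PathAlgebra k V) →ₗ[(PathAlgebra k V)ᵐᵒᵖ] (TipIndex T₀ V →₀ PathAlgebra k V) where
  toFun x := Finsupp.onFinset (Finset.univ.image (baseIndex e))
    (fun t => if t = baseIndex e t.place then x t.place else 0) fun t ht =>
      Finset.mem_image.2 ⟨t.place, Finset.mem_univ _, (ite_ne_right_iff.1 ht).1.symm⟩
  map_add' x y := by
    ext1 t
    simp only [Finsupp.onFinset_apply, Finsupp.add_apply, Pi.add_apply]
    split_ifs
    · rfl
    · rw [add_zero]
  map_smul' c x := by
    ext1 t
    simp only [Finsupp.onFinset_apply, Finsupp.smul_apply, Pi.smul_apply, RingHom.id_apply]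
    split_ifs
    · rfl
    · rw [smul_zero]

@[simp]
theorem baseVec_baseIndex (e : T₀ → V) (x : T₀ → PathAlgebra k V) (j : T₀) :
    baseVec e x (baseIndex e j) = x j :=
  if_pos rfl

theorem occurs_baseVec {e : T₀ → V} {x : T₀ → PathAlgebra k V} {t : TipIndex T₀ V} {u : QPath V}
    (h : Occurs (baseVec e x) t u) : t = baseIndex e t.place ∧ coeff (x t.place) u ≠ 0 := by
  by_cases ht : t = baseIndex e t.place
  · refine ⟨ht, ?_⟩
    rw [ht, Occurs, baseVec_baseIndex] at h
    exact h
  · have : baseVec e x t = 0 := if_neg ht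
    simp [Occurs, this] at h

theorem isSupportedOn_baseVec {e : T₀ → V} {x : T₀ → PathAlgebra k V}
    (hx : ∀ j p, coeff (x j) p ≠ 0 → p.src = e j) :
    IsSupportedOn (Set.range (baseIndex e)) (baseVec e x) := by
  intro t u ho
  obtain ⟨h1, h2⟩ := occurs_baseVec ho
  refine ⟨⟨t.place, h1.symm⟩, ?_⟩
  rw [hx _ _ h2, h1]
  rfl

theorem IsSupportedOn.eq_baseVec {e : T₀ → V} {x : TipIndex T₀ V →₀ PathAlgebra k V}
    (hx : IsSupportedOn (Set.range (baseIndex e)) x) :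
    baseVec e (fun j => x (baseIndex e j)) = x := by
  refine Finsupp.ext fun t => coeff_ext fun u => ?_
  by_cases ht : t = baseIndex e t.place
  · rw [ht, baseVec_baseIndex]
  · have h0 : baseVec e (fun j => x (baseIndex e j)) t = 0 := if_neg ht
    rw [h0]
    by_contra hne
    obtain ⟨⟨j, rfl⟩, -⟩ := hx t u (Ne.symm hne)
    exact ht rfl

variable [LinearOrder T₀] [LinearOrder (QPath V)]

theorem isLead_baseVec_iff {e : T₀ → V} {x : T₀ → PathAlgebra k V}
    (hx : ∀ j p, coeff (x j) p ≠ 0 → p.src = e j) {j : T₀} {p : QPath V} :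
    IsLead (baseVec e x) (baseIndex e j) p ↔ IsVecTip x j p := by
  rw [IsLead, Occurs, baseVec_baseIndex, IsVecTip]
  refine and_congr_right fun hp => ⟨fun h j' q hq => ?_, fun h t u ho => ?_⟩
  · have := h (baseIndex e j') q (by rwa [Occurs, baseVec_baseIndex])
    rwa [baseIndex_key (hx _ _ hq), baseIndex_key (hx _ _ hp), Prod.Lex.toLex_le_toLex] at this
  · obtain ⟨h1, h2⟩ := occurs_baseVec ho
    rw [h1, baseIndex_key (hx _ _ h2), baseIndex_key (hx _ _ hp), Prod.Lex.toLex_le_toLex]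
    exact h _ _ h2

variable {ι : Type*} {H : ι → T₀ → PathAlgebra k V}

/-- The tips of the members of a family of coordinate vectors. -/
def tipIndices (H : ι → T₀ → PathAlgebra k V) : Set (TipIndex T₀ V) :=
  {t | t.tail = t.word ∧ ∃ i, IsVecTip (H i) t.place t.word}

/-- The member of the family with a given tip. -/
def tipFamily (e : T₀ → V) (H : ι → T₀ → PathAlgebra k V) (t : TipIndex T₀ V) :
    TipIndex T₀ V →₀ PathAlgebra k V :=
  if h : t ∈ tipIndices H then baseVec e (H h.2.choose) else 0

theorem IsRightTipReduced.tipFamily_eq (hH : IsRightTipReduced H) (e : T₀ → V) {t : TipIndex T₀ V}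
    (ht : t.tail = t.word) {i : ι} (hi : IsVecTip (H i) t.place t.word) :
    tipFamily e H t = baseVec e (H i) := by
  have hm : t ∈ tipIndices H := ⟨ht, i, hi⟩
  rw [tipFamily, dif_pos hm, hH.eq_of_isVecTip hm.2.choose_spec hi
    (QPath.dvdLeft_iff.2 ⟨_, rfl, QPath.cat_vertex rfl⟩)]

theorem IsRightTipReduced.isLeadFamily (hH : IsRightTipReduced H) {e : T₀ → V} {deg : T₀ → ℤ}
    (he : ∀ i j p, coeff (H i j) p ≠ 0 → p.src = e j)
    (hdeg : ∀ i, ∃ c : ℤ, ∀ j p, coeff (H i j) p ≠ 0 → deg j + (p.len : ℤ) = c)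
    (htgt : ∀ i, ∃ a : V, ∀ j p, coeff (H i j) p ≠ 0 → p.tgt = a) :
    IsLeadFamily deg (Set.range (baseIndex e)) (tipIndices H) (tipFamily e H) where
  prefixFree := isPrefixFree_range_baseIndex e
  prefixFree' := by
    rintro ⟨j, q, p⟩ ⟨(rfl : p = q), i, hi⟩ ⟨j', q', p'⟩ ⟨(rfl : p' = q'), i', hi'⟩ h hd
    dsimp only at h hd hi hi'
    subst h
    obtain rfl := hH.eq_of_isVecTip hi hi' hd
    have h1 := hi.2 _ _ hi'.1
    have h2 := hi'.2 _ _ hi.1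
    have : p = p' := by
      rcases h1 with h1 | h1
      · rcases h2 with h2 | h2
        · exact absurd h1 h2.asymm
        · exact h2.1
      · exact h1.1.symm
    rw [this]
  eq_zero t ht := dif_neg ht
  supp := by
    rintro t ⟨h1, i, hi⟩
    rw [hH.tipFamily_eq e h1 hi]
    exact isSupportedOn_baseVec (he i)
  lead := by
    rintro ⟨j, q, p⟩ ⟨(rfl : p = q), i, hi⟩
    have hs := he i j _ hi.1
    rw [hH.tipFamily_eq e rfl hi]
    refine ⟨baseIndex e j, ⟨j, rfl⟩, hs.symm, ?_, (isLead_baseVec_iff (he i)).2 hi⟩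
    simp only [TipIndex.append, baseIndex]
    rw [QPath.vertex_cat hs.symm]
  cls := by
    rintro t ⟨h1, i, hi⟩ r p ho
    rw [hH.tipFamily_eq e h1 hi] at ho
    obtain ⟨h2, h3⟩ := occurs_baseVec ho
    obtain ⟨c, hc⟩ := hdeg i
    obtain ⟨a, ha⟩ := htgt i
    have hlen : r.word.len = 0 := by
      rw [h2]
      rfl
    rw [TipIndex.cls, hlen, ha _ _ h3, ha _ _ hi.1, hc _ _ hi.1, Nat.cast_zero, add_zero,
      hc _ _ h3]

end Initial

/-! ### The resolution attached to a Green–Solberg presentation -/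

section Presentation

variable {k : Type w} {V : Type u} [Field k] [Quiver.{v} V] [Fintype V]
  {I : Ideal (PathAlgebra k V)} [I.IsTwoSided]

theorem baseVec_eq_sum {T₀ : Type*} [Fintype T₀] (e : T₀ → V) (x : T₀ → PathAlgebra k V) :
    baseVec e x = ∑ j, Finsupp.single (baseIndex e j) (x j) := by
  refine Finsupp.ext fun t => ?_
  rw [Finsupp.finsetSum_apply]
  by_cases ht : t = baseIndex e t.place
  · rw [Finset.sum_eq_single t.place]
    · rw [ht, baseVec_baseIndex, ← ht]
      conv_rhs => rw [ht]
      exact (Finsupp.single_eq_same).symm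
    · intro j _ hj
      refine Finsupp.single_eq_of_ne fun h => hj ?_
      rw [h]
      rfl
    · exact fun h => absurd (Finset.mem_univ _) h
  · have h0 : baseVec e x t = 0 := if_neg ht
    rw [h0, Finset.sum_eq_zero]
    intro j _
    refine Finsupp.single_eq_of_ne fun h => ht ?_
    rw [h]
    rfl

namespace GradedProjectiveBasis

variable {P : Type*} [AddCommGroup P] [Module (PathAlgebra k V ⧸ I)ᵐᵒᵖ P]
  {gr : ℤ → AddSubgroup P} {T₀ : Type*} [Fintype T₀] (B : GradedProjectiveBasis I gr T₀)

theorem mem_pathModule_iff {x : T₀ → PathAlgebra k V} :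
    x ∈ B.pathModule ↔ ∀ j p, coeff (x j) p ≠ 0 → p.src = B.vtx j :=
  forall_congr' fun _ => vertex_mul_eq_iff

/-- The generators of `P` as values on `TipIndex`. -/
def baseGen (t : TipIndex T₀ V) : P :=
  if t = baseIndex B.vtx t.place then B.gen t.place else 0

theorem baseGen_mem (t : TipIndex T₀ V) : B.baseGen t ∈ gr (B.deg t.place + t.word.len) := by
  rw [baseGen]
  split_ifs with h
  · have : t.word.len = 0 := by
      rw [h]
      rfl
    rw [this, Nat.cast_zero, add_zero]
    exact B.gen_mem _
  · exact zero_mem _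

theorem evalMap_baseGen (x : T₀ → PathAlgebra k V) :
    evalMap B.baseGen (quotVec I (baseVec B.vtx x)) = B.proj x := by
  rw [baseVec_eq_sum, map_sum, map_sum, proj]
  refine Finset.sum_congr rfl fun j _ => ?_
  rw [quotVec_single, evalMap_single]
  congr 1
  exact if_pos rfl

theorem mem_of_proj_eq_zero {x : T₀ → PathAlgebra k V} (hx : x ∈ B.pathModule)
    (h : B.proj x = 0) (j : T₀) : x j ∈ I := by
  rw [← Ideal.Quotient.eq_zero_iff_mem]
  refine congrFun ((B.existsUnique_coords 0).unique (y₁ := fun j => Ideal.Quotient.mk I (x j))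
    (y₂ := 0) ⟨fun i => ?_, h⟩ ⟨fun i => mul_zero _, by simp⟩) j
  rw [← map_mul, hx i]

theorem exists_proj_eq (y : P) : ∃ x ∈ B.pathModule, B.proj x = y := by
  obtain ⟨a, ⟨ha, rfl⟩, -⟩ := B.existsUnique_coords y
  choose f hf using Ideal.Quotient.mk_surjective (I := I)
  refine ⟨fun j => ofPath k (QPath.vertex (B.vtx j)) * f (a j), fun j => ?_, ?_⟩
  · dsimp only
    rw [← mul_assoc]
    congr 1
    exact vertex_mul_eq_iff.2 fun p hp => by rw [← eq_of_coeff_ofPath_ne_zero hp, QPath.vertex_src]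
  · refine Finset.sum_congr rfl fun j _ => ?_
    rw [map_mul, hf, ha]

/-- The kernel of the composite `⨁ f_i k Q → P → X`. -/
def baseKernel {X : Type*} [AddCommGroup X] [Module (PathAlgebra k V ⧸ I)ᵐᵒᵖ X]
    (μ : P →ₗ[(PathAlgebra k V ⧸ I)ᵐᵒᵖ] X) :
    Submodule (PathAlgebra k V)ᵐᵒᵖ (TipIndex T₀ V →₀ PathAlgebra k V) where
  carrier := {x | IsSupportedOn (Set.range (baseIndex B.vtx)) x ∧
    μ (evalMap B.baseGen (quotVec I x)) = 0}
  add_mem' {x y} hx hy := ⟨hx.1.add hy.1, by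
    rw [map_add, map_add, map_add, hx.2, hy.2, add_zero]⟩
  zero_mem' := ⟨fun t u ho => absurd ho not_occurs_zero, by simp⟩
  smul_mem' c x hx := ⟨hx.1.smul c, by
    rw [← op_unop c, quotVec_smul, map_smul, map_smul, hx.2, smul_zero]⟩

end GradedProjectiveBasis

namespace GreenSolbergPresentation

variable [LinearOrder (QPath V)] {X : Type*} [AddCommGroup X]
  [Module (PathAlgebra k V ⧸ I)ᵐᵒᵖ X] {P : Type*} [AddCommGroup P]
  [Module (PathAlgebra k V ⧸ I)ᵐᵒᵖ P] {gr : ℤ → AddSubgroup P}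
  {μ : P →ₗ[(PathAlgebra k V ⧸ I)ᵐᵒᵖ] X} {T₀ : Type*} [Fintype T₀] [LinearOrder T₀]
  {B : GradedProjectiveBasis I gr T₀} {T₁ T₁' : Type*} [Fintype T₁] [Fintype T₁']
  (D : GreenSolbergPresentation I μ B T₁ T₁') {G : Set (PathAlgebra k V)}

/-- The reduced tips of the elements of a presentation. -/
def initialSet (S : Set (QPath V)) : Set (TipIndex T₀ V) :=
  tipIndices (Sum.elim D.h D.h') ∩ {t | QPath.IsReduced S t.word}

/-- The elements of a presentation, indexed by their reduced tips. -/
def initialFamily (S : Set (QPath V)) (t : TipIndex T₀ V) :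
    TipIndex T₀ V →₀ PathAlgebra k V :=
  if t ∈ {t : TipIndex T₀ V | QPath.IsReduced S t.word} then
    tipFamily B.vtx (Sum.elim D.h D.h') t else 0

theorem src_eq (i : T₁ ⊕ T₁') (j : T₀) (p : QPath V)
    (hp : coeff (Sum.elim D.h D.h' i j) p ≠ 0) : p.src = B.vtx j :=
  B.mem_pathModule_iff.1 (D.mem_ker i).1 j p hp

theorem isLeadFamily_tipFamily :
    IsLeadFamily B.deg (Set.range (baseIndex B.vtx)) (tipIndices (Sum.elim D.h D.h'))
      (tipFamily B.vtx (Sum.elim D.h D.h')) := by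
  refine D.tipReduced.isLeadFamily D.src_eq ?_ ?_
  · rintro (i | i)
    · exact ⟨_, D.homogeneous i⟩
    · exact ⟨_, D.homogeneous' i⟩
  · intro i
    obtain ⟨a, ha⟩ := D.exists_vertex i
    exact ⟨a, fun j => mul_vertex_eq_iff.1 (ha j)⟩

/-- Every element of the kernel is a combination of the elements of the presentation. -/
theorem exists_evalMap_eq {x : T₀ → PathAlgebra k V} (hx : x ∈ B.pathModule)
    (h0 : μ (B.proj x) = 0) :
    ∃ y : TipIndex T₀ V →₀ PathAlgebra k V, IsSupportedOn (tipIndices (Sum.elim D.h D.h')) y ∧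
      evalMap (tipFamily B.vtx (Sum.elim D.h D.h')) y = baseVec B.vtx x := by
  obtain ⟨y, ⟨hy, rfl⟩, -⟩ := D.existsUnique_sum x hx h0
  have key : ∀ i, ∃ z : TipIndex T₀ V →₀ PathAlgebra k V, IsSupportedOn (tipIndices (Sum.elim D.h D.h')) z ∧
      evalMap (tipFamily B.vtx (Sum.elim D.h D.h')) z = baseVec B.vtx (y i) := by
    intro i
    obtain ⟨c, hc⟩ := Submodule.mem_span_singleton.1 (hy i)
    obtain ⟨a, ha⟩ := D.exists_vertex i
    have hne : baseVec B.vtx (Sum.elim D.h D.h' i) ≠ 0 := by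
      intro h
      refine D.tipReduced.1 i (funext fun j => ?_)
      rw [← baseVec_baseIndex B.vtx (Sum.elim D.h D.h' i) j, h]
      rfl
    obtain ⟨t, p, hl⟩ := exists_isLead hne
    obtain ⟨⟨j, rfl⟩, -⟩ := isSupportedOn_baseVec (D.src_eq i) t p hl.1
    have htip := (isLead_baseVec_iff (D.src_eq i)).1 hl
    have hmem : (⟨j, p, p⟩ : TipIndex T₀ V) ∈ tipIndices (Sum.elim D.h D.h') := ⟨rfl, i, htip⟩
    -- Multiplying the coefficient by the end vertex of the generator gives it the right source and
    -- does not change the product.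
    refine ⟨Finsupp.single ⟨j, p, p⟩ (ofPath k (QPath.vertex a) * unop c), ?_, ?_⟩
    · refine isSupportedOn_single hmem fun u hu => ?_
      have h1 : u.src = a := by
        refine vertex_mul_eq_iff.1 ?_ u hu
        rw [← mul_assoc]
        congr 1
        exact vertex_mul_eq_iff.2 fun p hp => by
          rw [← eq_of_coeff_ofPath_ne_zero hp, QPath.vertex_src]
      rw [h1]
      exact mul_vertex_eq_iff.1 (ha j) p htip.1
    · rw [evalMap_single, D.tipReduced.tipFamily_eq B.vtx (t := ⟨j, p, p⟩) rfl htip, ← map_smul,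
        op_mul, mul_smul, op_unop, ← hc]
      congr 2
      funext j
      exact ha j
  choose z hz hze using key
  refine ⟨∑ i, z i, ?_, ?_⟩
  · exact Finset.sum_induction z (IsSupportedOn _) (fun _ _ => IsSupportedOn.add)
      (fun t u ho => absurd ho not_occurs_zero) fun i _ => hz i
  · rw [map_sum, map_sum]
    exact Finset.sum_congr rfl fun i _ => hze i

/-- Completeness: a kernel element is a combination of the presentation elements. Their tips are
prefix-free, so its leading term begins with one of these tips. If the leading term is reduced, so
is that tip, and discarding the elements with non-reduced tips loses nothing. -/
theorem isResolutionStep (hord : QPath.IsAdmissibleOrder V) :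
    IsResolutionStep B.deg I (tipSet G) (Set.range (baseIndex B.vtx)) (B.baseKernel μ)
      (D.initialSet (tipSet G)) (D.initialFamily (tipSet G)) := by
  refine ⟨D.isLeadFamily_tipFamily.restrict _, fun x hx => hx.1, ?_, ?_, ?_, ?_⟩
  · intro z hz hzI
    exact ⟨hz, by rw [quotVec_eq_zero_iff.2 hzI, map_zero, map_zero]⟩
  · rintro t ⟨⟨h1, i, hi⟩, hr⟩
    rw [initialFamily, if_pos hr, D.tipReduced.tipFamily_eq B.vtx h1 hi]
    refine ⟨isSupportedOn_baseVec (D.src_eq i), ?_⟩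
    rw [B.evalMap_baseGen, (D.mem_ker i).2]
  · rintro t ⟨⟨h1, -⟩, hr⟩
    rw [h1]
    exact hr
  · intro x hx r p hl hred
    have hxm : (fun j => x (baseIndex B.vtx j)) ∈ B.pathModule :=
      B.mem_pathModule_iff.2 fun j p hp => (hx.1 _ _ hp).2.symm
    obtain ⟨y, hy, e⟩ := D.exists_evalMap_eq hxm
      (by rw [← B.evalMap_baseGen, hx.1.eq_baseVec, hx.2])
    rw [hx.1.eq_baseVec] at e
    have hy0 : y ≠ 0 := by
      rintro rfl
      rw [map_zero] at e
      rw [← e] at hl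
      exact not_occurs_zero hl.1
    obtain ⟨t, w, hly⟩ := exists_isLead hy0
    obtain ⟨ht, hw⟩ := hy t w hly.1
    have hw' : t.tail.tgt = w.src := by rw [D.isLeadFamily_tipFamily.tail_tgt ht, hw]
    obtain ⟨r', hr', h4, h5, -, hl'⟩ := D.isLeadFamily_tipFamily.isLead_evalMap hord hy hly
    rw [e] at hl'
    obtain ⟨rfl, rfl⟩ := IsLead.unique (isPrefixFree_range_baseIndex B.vtx) hx.1 hl' hl
    refine ⟨t, ⟨ht, ?_⟩, w, hw, (TipIndex.key_tail h4 h5 hw').symm⟩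
    have := hred.left hw'
    rwa [ht.1] at this

/-- The tip of an `h'` is the tip of an entry in `I`, hence divisible by a tip of the Gröbner basis.
So only the `h i` have reduced tips. -/
theorem exists_deg_eq (hG : IsGroebnerBasis I G) {t : TipIndex T₀ V}
    (ht : t ∈ D.initialSet (tipSet G)) : ∃ i, B.deg t.place + (t.word.len : ℤ) = D.deg i := by
  obtain ⟨⟨-, i | i, hi⟩, hr⟩ := ht
  · exact ⟨i, D.homogeneous i _ _ hi.1⟩
  · obtain ⟨s, hs, hd⟩ := hG.2 _ (D.h'_mem i t.place) t.word
      ⟨hi.1, fun q hq => (hi.2 _ q hq).elim le_of_lt fun h => h.1.le⟩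
    exact absurd hd (hr s hs)

end GreenSolbergPresentation

theorem radSubmodule_eq_bot_of_forall_len_eq_zero {M : Type*} [AddCommGroup M]
    [Module (PathAlgebra k V ⧸ I)ᵐᵒᵖ M] (h : ∀ p : QPath V, p.len = 0) :
    radSubmodule I M = ⊥ := by
  refine eq_bot_iff.2 (Submodule.span_le.2 ?_)
  rintro _ ⟨x, m, hm, a, ⟨z, hz, rfl⟩, rfl⟩
  have : z = 0 := coeff_ext fun p => by
    by_contra hne
    have := hz p hne
    rw [h p] at this
    omega
  simp [this]

end Presentation

end

/-! ### The degree bounds -/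

theorem mainTheorem2 {k : Type w} [Field k] {V : Type u} [Quiver.{v} V] [Fintype V]
    [∀ a b : V, Finite (a ⟶ b)]
    -- an admissible order on the paths
    [LinearOrder (QPath V)] [WellFoundedLT (QPath V)] (hord : QPath.IsAdmissibleOrder V)
    -- the algebra `A = k Q / I` and a finite Gröbner basis of `I`
    (I : Ideal (PathAlgebra k V)) [I.IsTwoSided]
    (hI : PathAlgebra.IsHomogeneousRelationIdeal I)
    (G : Set (PathAlgebra k V)) (hGfin : G.Finite) (hG : PathAlgebra.IsGroebnerBasis I G)
    -- a finitely presented graded right module and its minimal graded projective resolution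
    {X : Type*} [AddCommGroup X] [Module (PathAlgebra k V ⧸ I)ᵐᵒᵖ X]
    (grX : ℤ → AddSubgroup X) (hX : IsGradedModule I grX)
    (hfp : Module.FinitePresentation (PathAlgebra k V ⧸ I)ᵐᵒᵖ X)
    (R : MinimalGradedResolution I grX)
    -- the Green–Solberg presentation
    {T₀ T₁ T₁' : Type*} [Fintype T₀] [LinearOrder T₀] [Fintype T₁] [Fintype T₁']
    (B : GradedProjectiveBasis I (R.gr 0) T₀)
    (D : GreenSolbergPresentation I R.aug B T₁ T₁')
    (a l : ℤ) (ha : IsLeast (Set.range D.deg) a) (hl : IsGreatest (Set.range D.deg) l)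
    (n : ℕ) (hn : 1 ≤ n) :
    Submodule.span (PathAlgebra k V ⧸ I)ᵐᵒᵖ
      {x : R.P n | ∃ j : ℤ,
        ((a : ℝ) : EReal) + QPath.minqo (PathAlgebra.tipSet G) (n - 1) ≤ ((j : ℝ) : EReal) ∧
        ((j : ℝ) : EReal) ≤ ((l : ℝ) : EReal) + QPath.maxqo (PathAlgebra.tipSet G) (n - 1) ∧
        x ∈ R.gr n j} = ⊤ := by
  obtain ⟨n, rfl⟩ : ∃ m, n = m + 1 := ⟨n - 1, by omega⟩
  rw [Nat.add_sub_cancel]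
  have := R.projective
  simp only [← and_assoc]
  refine span_eq_top_of_forall_notMem hI (R.graded (n + 1)) {j : ℤ |
    ((a : ℝ) : EReal) + QPath.minqo (PathAlgebra.tipSet G) n ≤ ((j : ℝ) : EReal) ∧
    ((j : ℝ) : EReal) ≤ ((l : ℝ) : EReal) + QPath.maxqo (PathAlgebra.tipSet G) n} a ?_ ?_
  -- Lengths are nonnegative, so `a` bounds the permitted degrees from below, also when `minqo` is
  -- infinite.
  · rintro j ⟨hj, -⟩
    have h0 : (0 : EReal) ≤ QPath.minqo (PathAlgebra.tipSet G) n :=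
      le_iInf₂ fun x _ => by exact_mod_cast Nat.zero_le _
    have h1 : ((a : ℝ) : EReal) ≤ ((j : ℝ) : EReal) := (le_add_of_nonneg_right h0).trans hj
    exact_mod_cast h1
  intro j hj x hx
  have H := D.isResolutionStep (G := G) hord
  obtain ⟨f, hf0, hf⟩ := H.exists_resolution hord hI hG
  -- Without paths of positive length there are no quasioverlaps of order zero, and the radicals
  -- vanish; this case is treated separately.
  by_cases hV : ∃ v : QPath V, 0 < v.len
  · refine R.mem_radSubmodule (T := chainSet (PathAlgebra.tipSet G) (D.initialSet (PathAlgebra.tipSet G))) hord hI hG hf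
      (fun t ht => ?_) (evalMap B.baseGen) (fun y hy h0 => ?_) (fun x => ?_) (fun t ht => ?_) n
      (fun t ht hdeg => hj ?_) hx
    · rw [hf0]
      exact H.eq_zero t ht
    · rw [hf0] at h0 ⊢
      have hs := H.isSupportedOn_evalMap hord hy
      set z := evalMap (D.initialFamily (PathAlgebra.tipSet G)) y with hz
      -- A vector that vanishes in `P 0 = ⨁ f_i A` has coordinates in `I`, by uniqueness of
      -- coordinates.
      rw [← hs.eq_baseVec, B.evalMap_baseGen] at h0
      intro t
      by_cases ht : z t = 0
      · rw [ht]
        exact I.zero_mem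
      · obtain ⟨u, hu⟩ : ∃ u, PathAlgebra.coeff (z t) u ≠ 0 := by
          by_contra! hne
          exact ht (PathAlgebra.coeff_ext hne)
        obtain ⟨⟨i, rfl⟩, -⟩ := hs t u hu
        exact B.mem_of_proj_eq_zero
          (B.mem_pathModule_iff.2 fun j p hp => (hs _ _ hp).2.symm) h0 i
    · obtain ⟨x₀, hx₀, e⟩ := B.exists_proj_eq (R.d 0 x)
      have hK : baseVec B.vtx x₀ ∈ B.baseKernel R.aug :=
        ⟨isSupportedOn_baseVec (B.mem_pathModule_iff.1 hx₀), by
          rw [B.evalMap_baseGen, e]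
          exact (R.exact_zero _).2 ⟨x, rfl⟩⟩
      rw [hf0, ← e, ← B.evalMap_baseGen]
      by_cases h0 : baseVec B.vtx x₀ = 0
      · exact ⟨0, fun t u ho => absurd ho not_occurs_zero, by rw [h0, map_zero]⟩
      obtain ⟨t, u, hlead⟩ := exists_isLead h0
      obtain ⟨y, hy, -, hyI⟩ := H.exists_division hord hI hG Set.univ (t.key u) _ hK
        fun r p ho => ⟨hlead.2 r p ho, trivial⟩
      refine ⟨y, hy, congrArg _ ?_⟩
      rw [← sub_eq_zero, ← neg_eq_zero, neg_sub, ← map_sub]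
      exact quotVec_eq_zero_iff.2 hyI
    · rw [hf0]
      exact ⟨evalMap_quotVec_mem (R.graded 0) B.baseGen_mem fun r p ho =>
        congrArg Prod.fst (H.cls t ht r p ho), (H.mem_ker t ht).2⟩
    -- A generator of degree `j` would put `j` in the permitted range: its degree is some `D.deg i`
    -- plus the length of a quasioverlap component.
    · obtain ⟨r, hr, q, hq, h1, h2⟩ := exists_quasiOverlap_of_chainSet
        (fun t ht => ⟨ht.1.1, ht.2⟩) hV n ht
      obtain ⟨i, hi⟩ := D.exists_deg_eq hG hr
      have hji : j = D.deg i + q.1.len := by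
        rw [← hdeg, ← hi, h1, h2]
        push_cast
        ring
      have e : ((j : ℝ) : EReal) = ((D.deg i : ℝ) : EReal) + ((q.1.len : ℕ) : EReal) := by
        rw [hji]
        push_cast
        rfl
      constructor
      · rw [e]
        refine add_le_add ?_ (iInf₂_le q hq)
        exact_mod_cast ha.2 ⟨i, rfl⟩
      · rw [e]
        refine add_le_add ?_ (le_iSup₂ (f := fun (x : QPath V × QPath V)
          (_ : x ∈ QPath.quasiOverlaps (PathAlgebra.tipSet G) n) => ((x.1.len : ℕ) : EReal)) q hq)
        exact_mod_cast hl.2 ⟨i, rfl⟩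
  -- With zero radical minimality forces the differentials to vanish, so by exactness `x` is a
  -- boundary and lies in the radical.
  · have hrad : R.d n x = 0 := by
      have h1 : R.d n x ∈ radSubmodule I (R.P n) := R.minimal n ⟨x, rfl⟩
      rw [radSubmodule_eq_bot_of_forall_len_eq_zero (by simpa using hV)] at h1
      exact h1
    obtain ⟨y, rfl⟩ := (R.exact_succ n x).1 hrad
    exact R.minimal (n + 1) ⟨y, rfl⟩
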